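/- **Trees.** A well-labeled tree is a locally finite (finite or infinite) plane rooted tree $T$ with labels $l:V(T)\to\mathbb Z$ such that labels of neighbouring vertices differ by at most $1$. For $x\in\mathbb Z$ let $GW(x)$ be the law of the Galton--Watson tree with offspring distribution $\mathrm{Geom}(1/2)$ (that is, $P(n)=2^{-n-1}$, $n\ge 0$), with root label $x$ and where, independently, the label of each non-root vertex is uniform in $\{\ell-1,\ell,\ell+1\}$, $\ell$ being the label of its parent; for $x\geq 1$ let $GW(x)^+$ be $GW(x)$ conditioned on all labels being positive. Let $\theta_\infty=(T_\infty,l_\infty)$ be the uniform infinite labeled tree: it has a single infinite spine, whose labels $(S_i)_{i\ge0}$ form a random walk started at $0$ with independent uniform steps in $\{-1,0,1\}$, and, given $(S_i)$, the subtrees attached to the left and to the right of the $i$-th spine vertex, $i\ge 0$, are independent with law $GW(S_i)$. For $m\ge 1$ and $(y_0,\dots,y_m)\in\mathbb Z^{m+1}$, let $\mu_{(y_0,\dots,y_m)}$ be the law of the forest $(\tilde\tau_i)_{0\le i\le m}$ obtained as follows: $I$ is uniform in $\{0,\dots,m\}$; given $I$, the trees are independent, $\tilde\tau_I$ is distributed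 as $(T_\infty,l_\infty+y_I)$, and $\tilde\tau_i$ has law $GW(y_i)$ for $i\ne I$. **The branch.** Fix an integer $k\ge1$. Let $e_0$ be the root of $\theta_\infty$ and let $e_k$ be the first corner with label $-k$ after the root corner in clockwise order (we also write $e_k$ for its vertex). Let $\theta_\infty^{(k)}$ be $\theta_\infty$ re-rooted at $e_k$, with labels $l_\infty+k$. Let $m_\infty$ be the graph distance between $e_k$ and $e_0$, let $x_{\infty,0}=e_k,\dots,x_{\infty,m_\infty}=e_0$ be the vertices of the path from $e_k$ to $e_0$, and let $X_{\infty,i}=l_\infty(x_{\infty,i})+k$. With $<$ the depth-first order and $\prec$ the ancestor relation in $T_\infty$, and all trees carrying the labels $l_\infty+k$: * for $1\le i\le m_\infty$, $\tau_{\infty,i}$ is the subtree, rooted at $x_{\infty,i}$, of the vertices $v$ with $x_{\infty,i}\le v<x_{\infty,i-1}$; * for $1\le i\le m_\infty$, $\tau'_{\infty,i}$ is the subtree, rooted at $x_{\infty,i}$, of $x_{\infty,i}$ and of the $v$ with $x_{\infty,i}\prec v$, $x_{\infty,i-1}<v$ and $x_{\infty,i-1}\not\prec v$; and $\tau'_{\infty,0}$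 is the subtree of $e_k$ and its descendants. Let $\mathcal M^+_{m,1\to k}$ be the set of walks $(x_1,\dots,x_m)$ of positive integers with $x_1=1$, $x_m=k$ and $|x_{i+1}-x_i|\le1$ for $1\le i<m$, and let $w(x)=\frac{x(x+3)}{(x+1)(x+2)}$. **Proposition.** Almost surely, $X_{\infty,0}=0$, $m_\infty\ge1$ and $(X_{\infty,1},\dots,X_{\infty,m_\infty})\in\mathcal M^+_{m_\infty,1\to k}$. For all $m\ge1$ and $\underline x=(x_1,\dots,x_m)\in\mathcal M^+_{m,1\to k}$, $$\mathbb P\big(m_\infty=m,\ (X_{\infty,1},\dots,X_{\infty,m})=\underline x\big)=\frac{m+1}{3^m}\prod_{i=1}^m w(x_i).$$ Moreover, conditionally on $m_\infty=m$ and $(X_{\infty,1},\dots,X_{\infty,m})=\underline x$: * the forests $(\tau_{\infty,i})_{1\le i\le m}$ and $(\tau'_{\infty,i})_{0\le i\le m}$ are independent; * the trees $\tau_{\infty,i}$, $1\le i\le m$, are independent, and $\tau_{\infty,i}$ has law $GW(x_i)^+$; * the forest $(\tau'_{\infty,i})_{0\le i\le m}$ has law $\mu_{(0,x_1,\dots,x_m)}$.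 -/

import Mathlib

open MeasureTheory ProbabilityTheory
open scoped ENNReal

namespace LabeledTree

/-! ### Well-labeled plane rooted trees -/

/-- A (finite or infinite, locally finite) well-labeled plane rooted tree, in Ulam–Harris coding:
a vertex is a finite word of natural numbers, the root is the empty word, and the children of `u`
are `u ++ [0], u ++ [1], …` from left to right. `label u` is the label of `u` if the word `u` is a
vertex, and `none` otherwise. Labels of neighbours differ by at most one. -/
@[ext]
structure WLTree where
  label : List ℕ → Option ℤ
  root_mem : (label []).isSome
  parent_mem : ∀ u c, (label (u ++ [c])).isSome → (label u).isSome
  sibling_mem : ∀ u c, (label (u ++ [c + 1])).isSome → (label (u ++ [c])).isSome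
  finite_children : ∀ u, ∃ c, label (u ++ [c]) = none
  label_step : ∀ u c a b, label u = some a → label (u ++ [c]) = some b → |b - a| ≤ 1

/-- The discrete σ-algebra on "label or not a vertex". -/
instance : MeasurableSpace (Option ℤ) := ⊤

/-- The σ-algebra generated by the events "`u` is a vertex with label `a`"; it is the Borel
σ-algebra of the local topology. -/
instance : MeasurableSpace WLTree := MeasurableSpace.comap WLTree.label inferInstance

namespace WLTree

/-- The vertex set. -/
def vertices (t : WLTree) : Set (List ℕ) := {u | (t.label u).isSome}

/-- The label of a vertex. -/
def lab (t : WLTree) (u : List ℕ) (hu : u ∈ t.vertices) : ℤ := (t.label u).get hu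

/-- The number of children of `u`. -/
def numChildren (t : WLTree) (u : List ℕ) : ℕ := Nat.find (t.finite_children u)

theorem mem_of_lt_numChildren (t : WLTree) (u : List ℕ) (c : ℕ) (h : c < t.numChildren u) :
    u ++ [c] ∈ t.vertices :=
  Option.isSome_iff_ne_none.2 (Nat.find_min (t.finite_children u) h)

theorem numChildren_spec (t : WLTree) (u : List ℕ) : t.label (u ++ [t.numChildren u]) = none :=
  Nat.find_spec (t.finite_children u)

theorem mem_of_prefix (t : WLTree) (u v : List ℕ) (h : u ++ v ∈ t.vertices) : u ∈ t.vertices := by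
  induction v using List.reverseRecOn with
  | nil => simpa using h
  | append_singleton v c ih =>
    exact ih (t.parent_mem (u ++ v) c (by simpa [vertices, List.append_assoc] using h))

theorem take_mem (t : WLTree) (u : List ℕ) (n : ℕ) (h : u ∈ t.vertices) :
    u.take n ∈ t.vertices :=
  t.mem_of_prefix (u.take n) (u.drop n) (by simpa using h)

/-- The tree with all labels translated by `a`, i.e. `(T, l + a)`. -/
def shift (t : WLTree) (a : ℤ) : WLTree where
  label u := (t.label u).map (· + a)
  root_mem := by simpa using t.root_mem
  parent_mem u c := by simpa using t.parent_mem u c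
  sibling_mem u c := by simpa using t.sibling_mem u c
  finite_children u := by simpa using t.finite_children u
  label_step u c x y hx hy := by
    simp only [Option.map_eq_some_iff] at hx hy
    obtain ⟨x', hx', rfl⟩ := hx
    obtain ⟨y', hy', rfl⟩ := hy
    simpa using t.label_step u c x' y' hx' hy'

theorem mem_shift (t : WLTree) (a : ℤ) (u : List ℕ) (hu : u ∈ t.vertices) :
    u ∈ (t.shift a).vertices := by
  simpa [vertices, shift] using hu

/-- The subtree made of all descendants of the vertex `v` (including `v`), rooted at `v`. -/
def descendants (t : WLTree) (v : List ℕ) (hv : v ∈ t.vertices) : WLTree where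
  label u := t.label (v ++ u)
  root_mem := by simpa [vertices] using hv
  parent_mem u c := by simpa using t.parent_mem (v ++ u) c
  sibling_mem u c := by simpa using t.sibling_mem (v ++ u) c
  finite_children u := by simpa using t.finite_children (v ++ u)
  label_step u c := by simpa using t.label_step (v ++ u) c

/-- The subtree rooted at the vertex `v` made of `v` and of the descendants of its children
`v ++ [0], …, v ++ [j - 1]`. When `v ++ [j]` is a vertex, its vertices are the `w` with
`v ≤ w < v ++ [j]` in depth-first order. -/
def leftPart (t : WLTree) (v : List ℕ) (hv : v ∈ t.vertices) (j : ℕ) : WLTree where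
  label u := match u with
    | [] => t.label v
    | c :: u => if c < j then t.label (v ++ c :: u) else none
  root_mem := hv
  parent_mem u c := by
    cases u with
    | nil => intro _; exact hv
    | cons d u =>
      have := t.parent_mem (v ++ d :: u) c
      by_cases h : d < j <;> simp_all
  sibling_mem u c := by
    cases u with
    | nil =>
      have := t.sibling_mem v c
      by_cases h : c + 1 < j
      · have h' : c < j := by omega
        simp_all
      · simp [h]
    | cons d u =>
      have := t.sibling_mem (v ++ d :: u) c
      by_cases h : d < j <;> simp_all
  finite_children u := by
    cases u with
    | nil => exact ⟨j, by simp⟩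
    | cons d u =>
      obtain ⟨c, hc⟩ := t.finite_children (v ++ d :: u)
      refine ⟨c, ?_⟩
      by_cases h : d < j <;> simp_all
  label_step u c a b := by
    cases u with
    | nil =>
      have := t.label_step v c a b
      by_cases h : c < j <;> simp_all
    | cons d u =>
      have := t.label_step (v ++ d :: u) c a b
      by_cases h : d < j <;> simp_all

/-- The subtree rooted at the vertex `v` made of `v` and of the descendants of its children
`v ++ [j + 1], v ++ [j + 2], …`. When `v ++ [j]` is a vertex, its vertices are `v` and the
descendants `w` of `v` such that `v ++ [j] < w` in depth-first order and `v ++ [j]` is not an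
ancestor of `w`. -/
def rightPart (t : WLTree) (v : List ℕ) (hv : v ∈ t.vertices) (j : ℕ) : WLTree where
  label u := match u with
    | [] => t.label v
    | c :: u => t.label (v ++ (c + j + 1) :: u)
  root_mem := hv
  parent_mem u c := by
    cases u with
    | nil => intro _; exact hv
    | cons d u => simpa using t.parent_mem (v ++ (d + j + 1) :: u) c
  sibling_mem u c := by
    cases u with
    | nil =>
      have := t.sibling_mem v (c + j + 1)
      rw [show c + j + 1 + 1 = c + 1 + j + 1 by ring] at this
      simpa using this
    | cons d u => simpa using t.sibling_mem (v ++ (d + j + 1) :: u) c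
  finite_children u := by
    cases u with
    | nil =>
      obtain ⟨c, hc⟩ := t.finite_children v
      have key : ∀ n, t.label (v ++ [c + n]) = none := by
        intro n
        induction n with
        | zero => exact hc
        | succ n ih =>
          by_contra h
          have := t.sibling_mem v (c + n) (Option.isSome_iff_ne_none.2 h)
          simp [ih] at this
      exact ⟨c, by simpa [add_assoc] using key (j + 1)⟩
    | cons d u => simpa using t.finite_children (v ++ (d + j + 1) :: u)
  label_step u c a b := by
    cases u with
    | nil => simpa using t.label_step v (c + j + 1) a b
    | cons d u => simpa using t.label_step (v ++ (d + j + 1) :: u) c a b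

/-! ### Corners and the vertex `e_k` -/

/-- The corner that follows a given corner in clockwise order. The corner `(u, j)` is the corner
at the vertex `u` just before its child `u ++ [j]` (just after its last child if `j` is the number
of children of `u`); `([], 0)` is the root corner. -/
def nextCorner (t : WLTree) (p : List ℕ × ℕ) : List ℕ × ℕ :=
  if p.2 < t.numChildren p.1 then (p.1 ++ [p.2], 0)
  else match p.1.getLast? with
    | none => ([], 0)
    | some c => (p.1.dropLast, c + 1)

/-- The corners `c_0, c_1, c_2, …` in clockwise order, starting from the root corner `c_0`. -/
def corner (t : WLTree) : ℕ → List ℕ × ℕ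
  | 0 => ([], 0)
  | n + 1 => t.nextCorner (t.corner n)

theorem corner_mem (t : WLTree) (n : ℕ) : (t.corner n).1 ∈ t.vertices := by
  induction n with
  | zero => exact t.root_mem
  | succ n ih =>
    simp only [corner, nextCorner]
    split_ifs with h
    · exact t.mem_of_lt_numChildren _ _ h
    · split
      · exact t.root_mem
      · rw [List.dropLast_eq_take]
        exact t.take_mem _ _ ih

/-- The vertex `e_k`: the vertex incident to the first corner with label `-k` after the root
corner, in clockwise order (the root, by convention, if there is no such corner). -/
noncomputable def e (t : WLTree) (k : ℕ) : List ℕ :=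
  (t.corner (sInf {n | t.label (t.corner n).1 = some (-(k : ℤ))})).1

theorem e_mem (t : WLTree) (k : ℕ) : t.e k ∈ t.vertices := t.corner_mem _

/-! ### The branch from `e_k` to the root and the trees attached to it -/

/-- `m`: the graph distance between `e_k` and the root `e_0`. -/
noncomputable def branchLength (t : WLTree) (k : ℕ) : ℕ := (t.e k).length

/-- `x_i`, `0 ≤ i ≤ m`: the vertices of the path from `x_0 = e_k` to `x_m = e_0`, that is, `x_i` is
the `i`-th ancestor of `e_k`. -/
noncomputable def branchVertex (t : WLTree) (k i : ℕ) : List ℕ :=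
  (t.e k).take (t.branchLength k - i)

theorem branchVertex_mem (t : WLTree) (k i : ℕ) : t.branchVertex k i ∈ t.vertices :=
  t.take_mem _ _ (t.e_mem k)

theorem branchVertex_mem_shift (t : WLTree) (k i : ℕ) (a : ℤ) :
    t.branchVertex k i ∈ (t.shift a).vertices :=
  t.mem_shift a _ (t.branchVertex_mem k i)

/-- For `1 ≤ i ≤ m`, the index `j` such that `x_{i-1}` is the child `x_i ++ [j]` of `x_i`. -/
noncomputable def branchIndex (t : WLTree) (k i : ℕ) : ℕ :=
  (t.e k).getD (t.branchLength k - i) 0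

theorem branchVertex_pred (t : WLTree) (k i : ℕ) (h1 : 1 ≤ i) (hi : i ≤ t.branchLength k) :
    t.branchVertex k (i - 1) = t.branchVertex k i ++ [t.branchIndex k i] := by
  have h : t.branchLength k - i < (t.e k).length := by
    unfold branchLength at *; omega
  unfold branchVertex branchIndex
  rw [show t.branchLength k - (i - 1) = t.branchLength k - i + 1 by omega,
    List.take_add_one, List.getD_eq_getElem _ _ h]
  simp [h]

/-- `X_i`: the label of `x_i` for the labels `l + k`. -/
noncomputable def X (t : WLTree) (k i : ℕ) : ℤ :=
  (t.shift k).lab (t.branchVertex k i) (t.branchVertex_mem_shift k i k)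

/-- `τ_i`, `1 ≤ i ≤ m`, with the labels `l + k`: the subtree of the `v` such that
`x_i ≤ v < x_{i-1}` in depth-first order. -/
noncomputable def tau (t : WLTree) (k i : ℕ) : WLTree :=
  (t.shift k).leftPart (t.branchVertex k i) (t.branchVertex_mem_shift k i k) (t.branchIndex k i)

/-- `τ'_i`, `0 ≤ i ≤ m`, with the labels `l + k`: for `i ≥ 1`, the subtree of `x_i` and of the
descendants `v` of `x_i` that come after `x_{i-1}` in depth-first order and do not descend from
`x_{i-1}`; for `i = 0`, the subtree of all descendants of `x_0 = e_k`. -/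
noncomputable def tau' (t : WLTree) (k : ℕ) : ℕ → WLTree
  | 0 => (t.shift k).descendants (t.branchVertex k 0) (t.branchVertex_mem_shift k 0 k)
  | i + 1 => (t.shift k).rightPart (t.branchVertex k (i + 1))
      (t.branchVertex_mem_shift k (i + 1) k) (t.branchIndex k (i + 1))

end WLTree

/-! ### Galton–Watson trees -/

/-- The uniform law on the three possible label increments; `i : Fin 3` codes the
increment `i - 1`. -/
noncomputable def stepLaw : Measure (Fin 3) := (PMF.uniformOfFintype (Fin 3)).toMeasure

/-- The label increment coded by an element of `Fin 3`. -/
def step (i : Fin 3) : ℤ := (i : ℕ) - 1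

theorem abs_step_le (i : Fin 3) : |step i| ≤ 1 := by
  fin_cases i <;> simp [step]

instance : IsProbabilityMeasure stepLaw := by unfold stepLaw; infer_instance

/-- A family of numbers of children and of label increments, indexed by all words. -/
abbrev GWNoise : Type := List ℕ → ℕ × Fin 3

/-- All numbers of children are geometric, `P(n) = 2 ^ (-n - 1)` for `n ≥ 0`, all label increments
are uniform in `{-1, 0, 1}`, and all these variables are independent. -/
noncomputable def gwNoiseLaw : Measure GWNoise :=
  Measure.infinitePi fun _ : List ℕ =>
    (geometricMeasure ⟨1 / 2, by norm_num, by norm_num⟩).prod stepLaw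

instance : IsProbabilityMeasure gwNoiseLaw := by unfold gwNoiseLaw; infer_instance

/-- The labels of the tree with root label `x` in which the vertex `u` has `(ω u).1` children, and
the label of a vertex `u` other than the root is that of its parent plus `step (ω u).2`. -/
def gwLabel : ℤ → GWNoise → List ℕ → Option ℤ
  | x, _, [] => some x
  | x, ω, c :: u =>
    if c < (ω []).1 then gwLabel (x + step (ω [c]).2) (fun v => ω (c :: v)) u else none

/-- The labeled Galton–Watson tree with root label `x` driven by `ω`. -/
def gwTree (x : ℤ) (ω : GWNoise) : WLTree where
  label := gwLabel x ω
  root_mem := by simp [gwLabel]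
  parent_mem u c := by
    induction u generalizing x ω with
    | nil => simp [gwLabel]
    | cons d u ih =>
      simp only [List.cons_append, gwLabel]
      split_ifs
      · exact ih _ _
      · simp
  sibling_mem u c := by
    induction u generalizing x ω with
    | nil =>
      simp only [List.nil_append, gwLabel]
      split_ifs <;> simp; omega
    | cons d u ih =>
      simp only [List.cons_append, gwLabel]
      split_ifs
      · exact ih _ _
      · simp
  finite_children u := by
    induction u generalizing x ω with
    | nil => exact ⟨(ω []).1, by simp [gwLabel]⟩
    | cons d u ih =>
      simp only [List.cons_append, gwLabel]
      split_ifs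
      · exact ih _ _
      · simp
  label_step u c a b := by
    induction u generalizing x ω with
    | nil =>
      simp only [List.nil_append, gwLabel]
      split_ifs
      · simp only [Option.some.injEq]
        rintro rfl rfl
        simpa using abs_step_le _
      · simp
    | cons d u ih =>
      simp only [List.cons_append, gwLabel]
      split_ifs
      · exact ih _ _
      · simp

/-- `GW(x)`: the law of the Galton–Watson tree with Geometric(1/2) offspring distribution, root
label `x`, and independent label increments uniform in `{-1, 0, 1}`. -/
noncomputable def GW (x : ℤ) : Measure WLTree := gwNoiseLaw.map (gwTree x)

/-- `GW(x)⁺`: the law `GW(x)` conditioned on all labels being positive. -/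
noncomputable def GWplus (x : ℤ) : Measure WLTree :=
  (GW x)[|{t | ∀ u a, t.label u = some a → 0 < a}]

/-! ### The uniform infinite labeled tree -/

/-- Labels of the tree with spine labels `S i, S (i + 1), …` whose left and right subtrees at the
successive spine vertices are `L i, L (i + 1), …` and `R i, R (i + 1), …`. The children of a spine
vertex are, from left to right, those of the root of its left subtree, the next spine vertex, and
those of the root of its right subtree. -/
def spineLabel (S : ℕ → ℤ) (L R : ℕ → WLTree) : ℕ → List ℕ → Option ℤ
  | i, [] => some (S i)
  | i, c :: u =>
    if c < (L i).numChildren [] then (L i).label (c :: u)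
    else if c = (L i).numChildren [] then spineLabel S L R (i + 1) u
    else (R i).label ((c - (L i).numChildren [] - 1) :: u)

/-- The tree with one distinguished spine, with spine labels `S i` and left and right subtrees
`L i` and `R i` attached at the spine vertices. -/
def spineTree (S : ℕ → ℤ) (L R : ℕ → WLTree) (hS : ∀ i, |S (i + 1) - S i| ≤ 1)
    (hL : ∀ i, (L i).label [] = some (S i)) (hR : ∀ i, (R i).label [] = some (S i)) : WLTree where
  label := spineLabel S L R 0
  root_mem := by simp [spineLabel]
  parent_mem u c := by
    generalize 0 = i
    induction u generalizing i with
    | nil => simp [spineLabel]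
    | cons d u ih =>
      simp only [List.cons_append, spineLabel]
      split_ifs
      · exact (L i).parent_mem (d :: u) c
      · exact ih _
      · exact (R i).parent_mem ((d - (L i).numChildren [] - 1) :: u) c
  sibling_mem u c := by
    generalize 0 = i
    induction u generalizing i with
    | nil =>
      simp only [List.nil_append, spineLabel]
      rcases lt_trichotomy (c + 1) ((L i).numChildren []) with h | h | h
      · rw [if_pos h, if_pos (by omega)]
        exact (L i).sibling_mem [] c
      · rw [if_pos (show c < _ by omega)]
        exact fun _ => (L i).mem_of_lt_numChildren [] c (by omega)
      · rw [if_neg (by omega), if_neg (by omega), if_neg (by omega)]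
        split_ifs with h'
        · simp
        · rw [show c + 1 - (L i).numChildren [] - 1 = (c - (L i).numChildren [] - 1) + 1 by omega]
          exact (R i).sibling_mem [] (c - (L i).numChildren [] - 1)
    | cons d u ih =>
      simp only [List.cons_append, spineLabel]
      split_ifs
      · exact (L i).sibling_mem (d :: u) c
      · exact ih _
      · exact (R i).sibling_mem ((d - (L i).numChildren [] - 1) :: u) c
  finite_children u := by
    generalize 0 = i
    induction u generalizing i with
    | nil =>
      refine ⟨(R i).numChildren [] + (L i).numChildren [] + 1, ?_⟩
      simp only [List.nil_append, spineLabel]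
      rw [if_neg (by omega), if_neg (by omega),
        show (R i).numChildren [] + (L i).numChildren [] + 1 - (L i).numChildren [] - 1
          = (R i).numChildren [] by omega]
      exact (R i).numChildren_spec []
    | cons d u ih =>
      simp only [List.cons_append, spineLabel]
      split_ifs
      · exact (L i).finite_children (d :: u)
      · exact ih _
      · exact (R i).finite_children ((d - (L i).numChildren [] - 1) :: u)
  label_step u c a b := by
    generalize 0 = i
    induction u generalizing i with
    | nil =>
      simp only [List.nil_append, spineLabel]
      intro ha
      split_ifs
      · exact (L i).label_step [] c a b ((hL i).trans ha)
      · intro hb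
        obtain rfl := Option.some.inj ha
        obtain rfl := Option.some.inj hb
        exact hS i
      · exact (R i).label_step [] _ a b ((hR i).trans ha)
    | cons d u ih =>
      simp only [List.cons_append, spineLabel]
      split_ifs
      · exact (L i).label_step (d :: u) c a b
      · exact ih _
      · exact (R i).label_step ((d - (L i).numChildren [] - 1) :: u) c a b

/-- For each level of the spine: a label increment, and the families that drive the left and the
right subtree. -/
abbrev SpineNoise : Type := ℕ → Fin 3 × GWNoise × GWNoise

/-- All components are independent. -/
noncomputable def spineNoiseLaw : Measure SpineNoise :=
  Measure.infinitePi fun _ : ℕ => stepLaw.prod (gwNoiseLaw.prod gwNoiseLaw)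

instance : IsProbabilityMeasure spineNoiseLaw := by unfold spineNoiseLaw; infer_instance

/-- The labels of the spine: a random walk started at `0` with uniform steps in `{-1, 0, 1}`. -/
def spineWalk (ω : SpineNoise) (i : ℕ) : ℤ := ∑ j ∈ Finset.range i, step (ω j).1

/-- The uniform infinite labeled tree: the spine labels `S_i` form a random walk started at `0`
with uniform steps in `{-1, 0, 1}` and, given these, the left and right subtrees at the spine
vertices are independent Galton–Watson trees `GW(S_i)`. -/
def uniformTree (ω : SpineNoise) : WLTree :=
  spineTree (spineWalk ω) (fun i => gwTree (spineWalk ω i) (ω i).2.1)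
    (fun i => gwTree (spineWalk ω i) (ω i).2.2)
    (fun i => by simpa [spineWalk, Finset.sum_range_succ] using abs_step_le _)
    (fun _ => rfl) (fun _ => rfl)

/-- The law of the uniform infinite labeled tree `θ_∞ = (T_∞, l_∞)`. -/
noncomputable def uniformLaw : Measure WLTree := spineNoiseLaw.map uniformTree

/-- `μ_{(y_0, …, y_m)}`: the law of a forest of `m + 1` independent trees with root labels
`y_0, …, y_m`, where, for `I` uniform in `{0, …, m}`, the `I`-th tree has the law of
`(T_∞, l_∞ + y_I)` and every other `i`-th tree has the law `GW(y_i)`. -/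
noncomputable def forestLaw (m : ℕ) (y : Fin (m + 1) → ℤ) : Measure (Fin (m + 1) → WLTree) :=
  ((m : ℝ≥0∞) + 1)⁻¹ • ∑ I : Fin (m + 1), Measure.pi fun i : Fin (m + 1) =>
    if i = I then uniformLaw.map (fun t => t.shift (y i)) else GW (y i)

/-! ### Positive walks and the weight `w` -/

/-- `(x_1, …, x_m)` is a walk with positive integer values and increments in `{-1, 0, 1}`, from
`x_1 = a` to `x_m = b` (only the values `x_1, …, x_m` of the sequence matter). -/
structure IsPosWalk (m : ℕ) (a b : ℤ) (x : ℕ → ℤ) : Prop where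
  one_le : 1 ≤ m
  first : x 1 = a
  last : x m = b
  pos : ∀ i, 1 ≤ i → i ≤ m → 0 < x i
  step_le : ∀ i, 1 ≤ i → i < m → |x (i + 1) - x i| ≤ 1

/-- The weight `w(x) = x (x + 3) / ((x + 1) (x + 2))`. -/
noncomputable def w (x : ℤ) : ℝ := (x * (x + 3) : ℝ) / ((x + 1) * (x + 2))

/-- The event that `m_∞ = m` and `(X_{∞,1}, …, X_{∞,m}) = (x_1, …, x_m)`. -/
def branchEvent (k m : ℕ) (x : ℕ → ℤ) : Set WLTree :=
  {t | t.branchLength k = m ∧ ∀ i, 1 ≤ i → i ≤ m → t.X k i = x i}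

/-! ### The maps that define `GW(x)` and the law of `θ_∞` are measurable -/

theorem measurable_label (u : List ℕ) : Measurable fun t : WLTree => t.label u :=
  (measurable_pi_apply u).comp (comap_measurable WLTree.label)

theorem measurable_wlTree {α : Type*} [MeasurableSpace α] {f : α → WLTree}
    (hf : ∀ u, Measurable fun a => (f a).label u) : Measurable f :=
  measurable_comap_iff.2 (measurable_pi_iff.2 hf)

theorem measurable_numChildren (u : List ℕ) : Measurable fun t : WLTree => t.numChildren u :=
  measurable_find (fun t : WLTree => t.finite_children u)
    fun c => measurable_label (u ++ [c]) (MeasurableSet.of_discrete (s := {none}))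

theorem measurable_gwLabel (u : List ℕ) :
    Measurable fun p : ℤ × GWNoise => gwLabel p.1 p.2 u := by
  induction u with
  | nil => exact (Measurable.of_discrete (f := fun x : ℤ => some x)).comp measurable_fst
  | cons c u ih =>
    simp only [gwLabel]
    refine Measurable.ite ?_ (ih.comp (Measurable.prodMk ?_ ?_)) measurable_const
    · exact measurableSet_lt measurable_const
        (measurable_fst.comp ((measurable_pi_apply []).comp measurable_snd))
    · exact measurable_fst.add ((Measurable.of_discrete (f := step)).comp
        (measurable_snd.comp ((measurable_pi_apply [c]).comp measurable_snd)))
    · exact measurable_pi_iff.2 fun v => (measurable_pi_apply (c :: v)).comp measurable_snd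

theorem measurable_gwTree : Measurable fun p : ℤ × GWNoise => gwTree p.1 p.2 :=
  measurable_wlTree measurable_gwLabel

instance (x : ℤ) : IsProbabilityMeasure (GW x) :=
  Measure.isProbabilityMeasure_map (measurable_gwTree.comp measurable_prodMk_left).aemeasurable

theorem measurable_spineWalk (i : ℕ) : Measurable fun ω : SpineNoise => spineWalk ω i :=
  Finset.measurable_sum _ fun j _ => (Measurable.of_discrete (f := step)).comp
    (measurable_fst.comp (measurable_pi_apply j))

theorem measurable_spineLabel {α : Type*} [MeasurableSpace α] {S : α → ℕ → ℤ}
    {L R : α → ℕ → WLTree} (hS : ∀ i, Measurable fun a => S a i)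
    (hL : ∀ i, Measurable fun a => L a i) (hR : ∀ i, Measurable fun a => R a i) (u : List ℕ) :
    ∀ i, Measurable fun a => spineLabel (S a) (L a) (R a) i u := by
  induction u with
  | nil => exact fun i => (Measurable.of_discrete (f := fun x : ℤ => some x)).comp (hS i)
  | cons c u ih =>
    intro i
    have hd : Measurable fun a => (L a i).numChildren [] := (measurable_numChildren []).comp (hL i)
    have hr : Measurable fun p : ℕ × WLTree => p.2.label ((c - p.1 - 1) :: u) :=
      measurable_from_prod_countable_right fun d => measurable_label ((c - d - 1) :: u)
    simp only [spineLabel]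
    refine Measurable.ite (measurableSet_lt measurable_const hd)
      ((measurable_label (c :: u)).comp (hL i)) (Measurable.ite ?_ (ih (i + 1)) ?_)
    · exact measurableSet_eq_fun measurable_const hd
    · exact hr.comp (hd.prodMk (hR i))

theorem measurable_uniformTree : Measurable uniformTree :=
  measurable_wlTree fun u => measurable_spineLabel measurable_spineWalk
    (fun i => measurable_gwTree.comp ((measurable_spineWalk i).prodMk
      (measurable_fst.comp (measurable_snd.comp (measurable_pi_apply i)))))
    (fun i => measurable_gwTree.comp ((measurable_spineWalk i).prodMk
      (measurable_snd.comp (measurable_snd.comp (measurable_pi_apply i))))) u 0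

instance : IsProbabilityMeasure uniformLaw :=
  Measure.isProbabilityMeasure_map measurable_uniformTree.aemeasurable

end LabeledTree

open LabeledTree

/-! The vertex `e_k` can be recognised without running the exploration. It is the only vertex `v` of
label `-k` such that every tree hanging to the left of the branch from the root to `v` is finite and
has positive labels once `k` is added. Finiteness makes the clockwise exploration reach `v`, and
positivity means that it meets no label `-k` before (`IsBranch.eq_e`, with converse `tau_mem`; both
combined in `exists_isBranch_iff`). The probability that the branch has given labels and that the
attached trees lie in given sets is therefore the expectation of a sum over the vertices at height
`m` in which at most one term is nonzero (`branchSum_indicator`).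

Such an expectation is computed level by level. Since `2^(-(n+1)) = 2^(-(j+1)) * 2^(-(n-j))`,
choosing one of `n` children, with `j` siblings on its left and `n-j-1` on its right, turns the
geometric weight into two independent geometric weights of total mass one. So the sum over children
of `f(left) h(child) g(right)` factorises exactly (`lintegral_rootSum_GW`), and prescribing the
label of the child costs `1/3`. In the infinite tree the chosen child is on the spine, or the spine
passes to its right; a spine on the left would make a left tree infinite
(`lintegral_rootSum_uniformLawAt`). After `m` levels the infinite part occupies one of the `m + 1`
right-hand positions, the tip included, which gives both the factor `m + 1` and the mixture
`forestLaw` (`lintegral_branchSum_uniformLawAt`).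

Each left tree contributes `GW(x)(all labels positive)`, which equals `w(x)`: both sequences satisfy
the same recursion, and this recursion has a unique solution with values in `[0, 1]` that vanishes
at `0` and is positive afterwards (`PositiveRec.unique`, `GW_positiveTrees`). Finally, `e_k` exists
almost surely: the left trees are finite, so the exploration climbs the whole spine, and the labels
of the spine hit `-k` (`ae_hits`). The resulting product formula on boxes determines the joint law.
-/

namespace LabeledTree

/-! ### Independent families -/

section Iid

variable {ι Ω : Type*} [MeasurableSpace Ω]

/-- The family indexed by `Option ι` with value `p.1` at `none` and `p.2 i` at `some i`. -/
def optionCons (p : Ω × (ι → Ω)) : Option ι → Ω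
  | none => p.1
  | some i => p.2 i

theorem measurable_optionCons : Measurable (optionCons : Ω × (ι → Ω) → Option ι → Ω) :=
  measurable_pi_iff.2 fun i => match i with
    | none => measurable_fst
    | some i => (measurable_pi_apply i).comp measurable_snd

theorem map_optionCons (μ : Measure Ω) [IsProbabilityMeasure μ] :
    (μ.prod (Measure.infinitePi fun _ : ι => μ)).map optionCons
      = Measure.infinitePi fun _ : Option ι => μ := by
  classical
  refine Measure.eq_infinitePi _ fun s t ht => ?_
  -- Padding with `univ` allows the index set to be enlarged by `none`, whose coordinate then splits
  -- off the product.
  let t' : Option ι → Set Ω := fun i => if i ∈ s then t i else Set.univ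
  have ht' : ∀ i, MeasurableSet (t' i) := by
    intro i
    by_cases h : i ∈ s <;> simp [t', h, ht]
  have hpi : (s : Set (Option ι)).pi t = ((s.eraseNone.insertNone : Finset (Option ι)) : Set (Option ι)).pi t' := by
    ext q
    simp only [Set.mem_pi, Finset.mem_coe, t']
    refine ⟨fun h i _ => ?_, fun h i hi => ?_⟩
    · split_ifs with hi
      · exact h i hi
      · trivial
    · have := h i (by cases i <;> simp [hi])
      simpa [hi] using this
  have hprod : ∏ i ∈ s, μ (t i) = ∏ i ∈ s.eraseNone.insertNone, μ (t' i) := by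
    rw [Finset.prod_congr rfl fun i (hi : i ∈ s) => show μ (t i) = μ (t' i) by simp [t', hi]]
    refine Finset.prod_subset (fun i hi => ?_) fun i _ hi => by simp [t', hi]
    cases i <;> simp [hi]
  rw [hpi, hprod, Measure.map_apply measurable_optionCons
    (MeasurableSet.pi (Finset.countable_toSet _) fun i _ => ht' i), Finset.prod_insertNone]
  have : optionCons ⁻¹' ((s.eraseNone.insertNone : Finset (Option ι)) : Set (Option ι)).pi t'
      = t' none ×ˢ ((s.eraseNone : Finset ι) : Set ι).pi fun i => t' (some i) := by
    ext ⟨a, q⟩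
    simp only [Set.mem_preimage, Set.mem_pi, Finset.mem_coe, Set.mem_prod]
    constructor
    · intro h
      exact ⟨h none (by simp), fun i hi => h (some i) (by simpa using hi)⟩
    · rintro ⟨h0, h⟩ i hi
      cases i with
      | none => exact h0
      | some i => exact h i (by simpa using hi)
  rw [this, Measure.prod_prod, Measure.infinitePi_pi _ fun i _ => ht' _]

theorem map_optionCons_congr {κ : Type*} (e : Option ι ≃ κ) (μ : Measure Ω)
    [IsProbabilityMeasure μ] :
    (μ.prod (Measure.infinitePi fun _ : ι => μ)).map (fun p i => optionCons p (e.symm i))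
      = Measure.infinitePi fun _ : κ => μ := by
  have h := Measure.infinitePi_map_piCongrLeft (μ := fun _ : κ => μ) e
  rw [← h, ← map_optionCons, Measure.map_map (MeasurableEquiv.measurable _) measurable_optionCons]
  congr 1
  ext p i
  obtain ⟨j, rfl⟩ := e.surjective i
  simp [MeasurableEquiv.coe_piCongrLeft, Equiv.piCongrLeft_apply_apply]

/-- The sequence `a, q 0, q 1, …`. -/
def seqCons (a : Ω) (q : ℕ → Ω) : ℕ → Ω
  | 0 => a
  | n + 1 => q n

theorem measurable_seqCons : Measurable fun p : Ω × (ℕ → Ω) => seqCons p.1 p.2 :=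
  measurable_pi_iff.2 fun i => match i with
    | 0 => measurable_fst
    | i + 1 => (measurable_pi_apply i).comp measurable_snd

theorem map_seqCons (μ : Measure Ω) [IsProbabilityMeasure μ] :
    (μ.prod (Measure.infinitePi fun _ : ℕ => μ)).map (fun p => seqCons p.1 p.2)
      = Measure.infinitePi fun _ : ℕ => μ := by
  let e : Option ℕ ≃ ℕ :=
    { toFun := fun i => i.elim 0 (· + 1)
      invFun := fun n => match n with
        | 0 => none
        | n + 1 => some n
      left_inv := by rintro (_ | i) <;> rfl
      right_inv := by rintro (_ | i) <;> rfl }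
  refine Eq.trans ?_ (map_optionCons_congr e μ)
  congr 1
  ext p i
  cases i <;> rfl

theorem lintegral_infinitePi_seqCons (μ : Measure Ω) [IsProbabilityMeasure μ]
    {f : (ℕ → Ω) → ℝ≥0∞} (hf : Measurable f) :
    ∫⁻ q, f q ∂Measure.infinitePi (fun _ : ℕ => μ)
      = ∫⁻ a, ∫⁻ q, f (seqCons a q) ∂Measure.infinitePi (fun _ : ℕ => μ) ∂μ := by
  conv_lhs => rw [← map_seqCons, lintegral_map hf measurable_seqCons]
  exact lintegral_prod _ (hf.comp measurable_seqCons).aemeasurable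

/-- The three factors read the coordinates before, at and after `j`, hence are independent. The
induction peels off coordinate `0`, which only `F` sees while `j` is positive. -/
theorem lintegral_infinitePi_split (μ : Measure Ω) [IsProbabilityMeasure μ] (j : ℕ)
    {F G : (ℕ → Ω) → ℝ≥0∞} {H : Ω → ℝ≥0∞} (hF : Measurable F) (hG : Measurable G)
    (hH : Measurable H) (hFj : ∀ q q', (∀ i < j, q i = q' i) → F q = F q') :
    ∫⁻ q, F q * H (q j) * G (fun i => q (i + j + 1)) ∂Measure.infinitePi (fun _ : ℕ => μ)
      = (∫⁻ q, F q ∂Measure.infinitePi (fun _ : ℕ => μ)) * (∫⁻ a, H a ∂μ)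
        * ∫⁻ q, G q ∂Measure.infinitePi (fun _ : ℕ => μ) := by
  have hm : ∀ j, Measurable fun q : ℕ → Ω => fun i => q (i + j + 1) := fun j =>
    measurable_pi_iff.2 fun i => measurable_pi_apply _
  induction j generalizing F with
  | zero =>
    have : Nonempty (ℕ → Ω) := (Measure.infinitePi fun _ : ℕ => μ).nonempty_of_neZero
    obtain ⟨q₀⟩ := this
    -- For `j = 0` the agreement condition is vacuous, so `F` is constant.
    have hc : ∀ q, F q = F q₀ := fun q => hFj q q₀ (by simp)
    simp only [hc, lintegral_const, measure_univ, mul_one]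
    rw [lintegral_infinitePi_seqCons]
    · rw [← lintegral_const_mul _ hH, ← lintegral_mul_const _ (hH.const_mul _)]
      refine lintegral_congr fun a => ?_
      rw [← lintegral_const_mul _ hG]
      rfl
    · exact ((hH.comp (measurable_pi_apply 0)).const_mul _).mul (hG.comp (hm 0))
  | succ j ih =>
    have hFHG : Measurable fun q : ℕ → Ω => F q * H (q (j + 1)) * G fun i => q (i + (j + 1) + 1) :=
      (hF.mul (hH.comp (measurable_pi_apply _))).mul (hG.comp (hm _))
    rw [lintegral_infinitePi_seqCons _ hFHG]
    have hFa : ∀ a, Measurable fun q => F (seqCons a q) := fun a =>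
      hF.comp (measurable_seqCons.comp measurable_prodMk_left)
    rw [lintegral_infinitePi_seqCons _ hF]
    have : ∀ a, ∫⁻ q, F (seqCons a q) * H (seqCons a q (j + 1))
          * G (fun i => seqCons a q (i + (j + 1) + 1)) ∂Measure.infinitePi (fun _ : ℕ => μ)
        = (∫⁻ q, F (seqCons a q) ∂Measure.infinitePi (fun _ : ℕ => μ)) * (∫⁻ a, H a ∂μ)
          * ∫⁻ q, G q ∂Measure.infinitePi (fun _ : ℕ => μ) := by
      intro a
      rw [← ih (hFa a)]
      · rfl
      · intro q q' h
        refine hFj _ _ fun i hi => ?_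
        cases i with
        | zero => rfl
        | succ i => exact h i (by omega)
    simp only [this]
    have hm2 : Measurable fun a => ∫⁻ q, F (seqCons a q) ∂Measure.infinitePi (fun _ : ℕ => μ) :=
      (hF.comp measurable_seqCons).lintegral_prod_right'
    rw [lintegral_mul_const _ (hm2.mul_const _), lintegral_mul_const _ hm2]

end Iid

/-! ### The geometric law -/

/-- The offspring law `P(n) = 2 ^ (-n - 1)`. -/
noncomputable def offspringLaw : Measure ℕ :=
  geometricMeasure ⟨1 / 2, by norm_num, by norm_num⟩

instance : IsProbabilityMeasure offspringLaw := by unfold offspringLaw; infer_instance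

theorem lintegral_offspringLaw (f : ℕ → ℝ≥0∞) :
    ∫⁻ n, f n ∂offspringLaw = ∑' n : ℕ, (2⁻¹ : ℝ≥0∞) ^ (n + 1) * f n := by
  rw [offspringLaw, geometricMeasure_eq (by simp [Subtype.ext_iff]), lintegral_sum_measure]
  refine tsum_congr fun n => ?_
  rw [lintegral_smul_measure, lintegral_dirac, smul_eq_mul]
  congr 1
  rw [show ((1 : ℝ) - (1 / 2)) ^ n * (1 / 2) = (2⁻¹ : ℝ) ^ (n + 1) by rw [pow_succ]; norm_num,
    ENNReal.ofReal_pow (by norm_num), ENNReal.ofReal_inv_of_pos (by norm_num)]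
  norm_num

/-- A Cauchy product, resting on `n + 1 = (j + 1) + ((n - j - 1) + 1)`. This is the property of the
Geometric(1/2) law behind the whole computation: the numbers of siblings on the two sides of a
chosen child are independent and geometric, with no extra constant. -/
theorem tsum_offspring_split (a b : ℕ → ℝ≥0∞) :
    ∑' n : ℕ, (2⁻¹ : ℝ≥0∞) ^ (n + 1) * ∑ j ∈ Finset.range n, a j * b (n - j - 1)
      = (∑' n : ℕ, (2⁻¹ : ℝ≥0∞) ^ (n + 1) * a n) * ∑' n : ℕ, (2⁻¹ : ℝ≥0∞) ^ (n + 1) * b n := by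
  rw [tsum_eq_zero_add' ENNReal.summable]
  simp only [Finset.range_zero, Finset.sum_empty, mul_zero, zero_add]
  have : ∀ n : ℕ, (2⁻¹ : ℝ≥0∞) ^ (n + 1 + 1) * ∑ j ∈ Finset.range (n + 1), a j * b (n + 1 - j - 1)
      = ∑ p ∈ Finset.HasAntidiagonal.antidiagonal n,
        ((2⁻¹ : ℝ≥0∞) ^ (p.1 + 1) * a p.1) * ((2⁻¹ : ℝ≥0∞) ^ (p.2 + 1) * b p.2) := by
    intro n
    rw [Finset.Nat.sum_antidiagonal_eq_sum_range_succ
      (fun i j => ((2⁻¹ : ℝ≥0∞) ^ (i + 1) * a i) * ((2⁻¹ : ℝ≥0∞) ^ (j + 1) * b j)), Finset.mul_sum]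
    refine Finset.sum_congr rfl fun j hj => ?_
    have hj : j ≤ n := by simpa [Nat.lt_succ_iff] using hj
    rw [show n + 1 - j - 1 = n - j by omega, show n + 1 + 1 = (j + 1) + (n - j + 1) by omega,
      pow_add]
    ring
  simp only [this]
  simp_rw [← ENNReal.tsum_mul_right, ← ENNReal.tsum_mul_left]
  rw [← ENNReal.tsum_prod, ← Finset.HasAntidiagonal.sigmaAntidiagonalEquivProd.tsum_eq, ENNReal.tsum_sigma']
  refine tsum_congr fun n => ?_
  rw [← Finset.tsum_subtype]
  rfl

/-! ### Decomposition of a tree at a child of its root -/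

namespace WLTree

theorem numChildren_eq (t : WLTree) (u : List ℕ) (n : ℕ) (hn : t.label (u ++ [n]) = none)
    (h : ∀ c < n, t.label (u ++ [c]) ≠ none) : t.numChildren u = n :=
  (Nat.find_eq_iff _).2 ⟨hn, h⟩

theorem label_append_eq_none (t : WLTree) (u : List ℕ) (c : ℕ) (h : t.numChildren u ≤ c) :
    t.label (u ++ [c]) = none := by
  induction c, h using Nat.le_induction with
  | base => exact t.numChildren_spec u
  | succ c _ ih =>
    by_contra h'
    exact absurd ih (Option.isSome_iff_ne_none.1
      (t.sibling_mem u c (Option.isSome_iff_ne_none.2 h')))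

theorem mem_vertices_append_iff (t : WLTree) (u : List ℕ) (c : ℕ) :
    u ++ [c] ∈ t.vertices ↔ c < t.numChildren u := by
  refine ⟨fun h => ?_, t.mem_of_lt_numChildren u c⟩
  by_contra h'
  have := t.label_append_eq_none u c (not_lt.1 h')
  simp [vertices, this] at h

/-- The part of the tree to the left of the `j`-th child of the root. -/
def leftR (t : WLTree) (j : ℕ) : WLTree := t.leftPart [] t.root_mem j

/-- The part of the tree to the right of the `j`-th child of the root. -/
def rightR (t : WLTree) (j : ℕ) : WLTree := t.rightPart [] t.root_mem j

/-- The subtree of the `j`-th child of the root, and the tree itself if there is no such child. -/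
noncomputable def childR (t : WLTree) (j : ℕ) : WLTree :=
  open Classical in if h : [j] ∈ t.vertices then t.descendants [j] h else t

theorem childR_eq (t : WLTree) (j : ℕ) (h : [j] ∈ t.vertices) :
    t.childR j = t.descendants [j] h := by
  simp [childR, h]

@[simp] theorem leftR_label_nil (t : WLTree) (j : ℕ) : (t.leftR j).label [] = t.label [] := rfl

@[simp] theorem leftR_label_cons (t : WLTree) (j c : ℕ) (u : List ℕ) :
    (t.leftR j).label (c :: u) = if c < j then t.label (c :: u) else none := rfl

@[simp] theorem rightR_label_nil (t : WLTree) (j : ℕ) : (t.rightR j).label [] = t.label [] := rfl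

@[simp] theorem rightR_label_cons (t : WLTree) (j c : ℕ) (u : List ℕ) :
    (t.rightR j).label (c :: u) = t.label ((c + j + 1) :: u) := rfl

theorem childR_label (t : WLTree) (j : ℕ) (h : j < t.numChildren []) (u : List ℕ) :
    (t.childR j).label u = t.label (j :: u) := by
  rw [childR_eq t j (t.mem_of_lt_numChildren [] j h)]
  rfl

theorem measurable_leftR (j : ℕ) : Measurable fun t : WLTree => t.leftR j := by
  refine measurable_wlTree fun u => ?_
  cases u with
  | nil => exact measurable_label []
  | cons c u =>
    simp only [leftR_label_cons]
    split_ifs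
    · exact measurable_label _
    · exact measurable_const

theorem measurable_rightR (j : ℕ) : Measurable fun t : WLTree => t.rightR j := by
  refine measurable_wlTree fun u => ?_
  cases u with
  | nil => exact measurable_label []
  | cons c u => exact measurable_label _

theorem measurableSet_mem_vertices (u : List ℕ) : MeasurableSet {t : WLTree | u ∈ t.vertices} :=
  measurable_label u (MeasurableSet.of_discrete (s := {a : Option ℤ | a.isSome}))

theorem measurable_childR (j : ℕ) : Measurable fun t : WLTree => t.childR j := by
  classical
  refine measurable_wlTree fun u => ?_
  have : (fun t : WLTree => (t.childR j).label u)
      = fun t => if [j] ∈ t.vertices then t.label (j :: u) else t.label u := by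
    ext1 t
    unfold childR
    split_ifs <;> rfl
  rw [this]
  exact Measurable.ite (measurableSet_mem_vertices _) (measurable_label _) (measurable_label _)

theorem measurable_shift (a : ℤ) : Measurable fun t : WLTree => t.shift a :=
  measurable_wlTree fun u =>
    (Measurable.of_discrete (f := Option.map (· + a))).comp (measurable_label u)

theorem numChildren_shift (t : WLTree) (a : ℤ) (u : List ℕ) :
    (t.shift a).numChildren u = t.numChildren u := by
  refine numChildren_eq _ _ _ ?_ fun c hc => ?_
  · simp [shift, t.numChildren_spec u]
  · simpa [shift] using Option.isSome_iff_ne_none.1 (t.mem_of_lt_numChildren u c hc)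

/-- The sum, over the children of the root, of a product of functions of the left part, of the
subtree of the child, and of the right part. -/
noncomputable def rootSum (f h g : WLTree → ℝ≥0∞) (t : WLTree) : ℝ≥0∞ :=
  ∑ j ∈ Finset.range (t.numChildren []), f (t.leftR j) * h (t.childR j) * g (t.rightR j)

theorem measurable_rootSum {f h g : WLTree → ℝ≥0∞} (hf : Measurable f) (hh : Measurable h)
    (hg : Measurable g) : Measurable (rootSum f h g) := by
  have : Measurable fun p : ℕ × WLTree =>
      ∑ j ∈ Finset.range p.1, f (p.2.leftR j) * h (p.2.childR j) * g (p.2.rightR j) :=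
    measurable_from_prod_countable_right fun n => by
      refine Finset.measurable_fun_sum (Finset.range n) fun j _ => ?_
      exact
      ((hf.comp (measurable_leftR j)).mul (hh.comp (measurable_childR j))).mul
        (hg.comp (measurable_rightR j))
  exact this.comp ((measurable_numChildren []).prodMk measurable_id)

end WLTree

open WLTree

/-! ### One-step decomposition of Galton–Watson trees -/

/-- The noise with value `a` at the root and `q c` on the subtree of the `c`-th child. -/
def gwCons (a : ℕ × Fin 3) (q : ℕ → GWNoise) : GWNoise
  | [] => a
  | c :: v => q c v

theorem measurable_gwCons : Measurable fun p : (ℕ × Fin 3) × (ℕ → GWNoise) => gwCons p.1 p.2 :=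
  measurable_pi_iff.2 fun u => match u with
    | [] => measurable_fst
    | c :: v => (measurable_pi_apply v).comp ((measurable_pi_apply c).comp measurable_snd)

theorem gwNoiseLaw_eq :
    gwNoiseLaw = Measure.infinitePi fun _ : List ℕ => offspringLaw.prod stepLaw := rfl

/-- The branching property at the level of noises: a word is empty or a first letter followed by a
word, so i.i.d. noise on words is a root value with an independent sequence of i.i.d. noises. -/
theorem map_gwCons :
    ((offspringLaw.prod stepLaw).prod (Measure.infinitePi fun _ : ℕ => gwNoiseLaw)).map
      (fun p => gwCons p.1 p.2) = gwNoiseLaw := by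
  let e : Option (ℕ × List ℕ) ≃ List ℕ :=
    { toFun := fun i => i.elim [] fun p => p.1 :: p.2
      invFun := fun u => match u with
        | [] => none
        | c :: v => some (c, v)
      left_inv := by rintro (_ | i) <;> rfl
      right_inv := by rintro (_ | i) <;> rfl }
  have h := map_optionCons_congr e (offspringLaw.prod stepLaw)
  have h2 := Measure.infinitePi_map_curry (ι := ℕ) (κ := List ℕ)
    (fun _ _ => offspringLaw.prod stepLaw)
  rw [gwNoiseLaw_eq, ← h2]
  refine Eq.trans ?_ h
  have h3 := Measure.map_prod_map (offspringLaw.prod stepLaw)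
    (Measure.infinitePi fun _ : ℕ × List ℕ => offspringLaw.prod stepLaw) measurable_id
    (MeasurableEquiv.measurable (MeasurableEquiv.curry ℕ (List ℕ) (ℕ × Fin 3)))
  rw [Measure.map_id] at h3
  rw [h3, Measure.map_map measurable_gwCons (measurable_id.prodMap (MeasurableEquiv.measurable _))]
  congr 1
  ext1 p
  funext u
  cases u <;> rfl

theorem lintegral_gwNoiseLaw {f : GWNoise → ℝ≥0∞} (hf : Measurable f) :
    ∫⁻ ω, f ω ∂gwNoiseLaw = ∫⁻ n, ∫⁻ s, ∫⁻ q, f (gwCons (n, s) q)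
      ∂Measure.infinitePi (fun _ : ℕ => gwNoiseLaw) ∂stepLaw ∂offspringLaw := by
  have h : Measurable fun p : (ℕ × Fin 3) × (ℕ → GWNoise) => f (gwCons p.1 p.2) :=
    hf.comp measurable_gwCons
  conv_lhs => rw [← map_gwCons, lintegral_map hf measurable_gwCons]
  rw [lintegral_prod _ h.aemeasurable, lintegral_prod _ h.lintegral_prod_right'.aemeasurable]

/-- If the value at a noise does not depend on the label increment at the root, the integral
reduces to an integral over the number of children and the noises of the children. -/
theorem lintegral_gwNoiseLaw_of_root {f : GWNoise → ℝ≥0∞} (hf : Measurable f)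
    (hs : ∀ n s q, f (gwCons (n, s) q) = f (gwCons (n, 0) q)) :
    ∫⁻ ω, f ω ∂gwNoiseLaw = ∫⁻ n, ∫⁻ q, f (gwCons (n, 0) q)
      ∂Measure.infinitePi (fun _ : ℕ => gwNoiseLaw) ∂offspringLaw := by
  simp [lintegral_gwNoiseLaw hf, hs]

/-- Combines the independence of the noises on the two sides of child `j` with the splitting of the
geometric weight. -/
theorem lintegral_offspring_split {Ω : Type*} [MeasurableSpace Ω] (μ : Measure Ω)
    [IsProbabilityMeasure μ] {F G : ℕ → (ℕ → Ω) → ℝ≥0∞} {H : Ω → ℝ≥0∞}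
    (hF : ∀ n, Measurable (F n)) (hG : ∀ n, Measurable (G n)) (hH : Measurable H)
    (hFj : ∀ j q q', (∀ i < j, q i = q' i) → F j q = F j q') :
    ∫⁻ n, ∫⁻ q, ∑ j ∈ Finset.range n, F j q * H (q j) * G (n - j - 1) (fun i => q (i + j + 1))
        ∂Measure.infinitePi (fun _ : ℕ => μ) ∂offspringLaw
      = (∫⁻ n, ∫⁻ q, F n q ∂Measure.infinitePi (fun _ : ℕ => μ) ∂offspringLaw) * (∫⁻ a, H a ∂μ)
        * ∫⁻ n, ∫⁻ q, G n q ∂Measure.infinitePi (fun _ : ℕ => μ) ∂offspringLaw := by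
  have h1 : ∀ n, ∫⁻ q, ∑ j ∈ Finset.range n,
        F j q * H (q j) * G (n - j - 1) (fun i => q (i + j + 1))
        ∂Measure.infinitePi (fun _ : ℕ => μ)
      = ∑ j ∈ Finset.range n, ((∫⁻ q, F j q ∂Measure.infinitePi (fun _ : ℕ => μ))
        * (∫⁻ a, H a ∂μ)) * ∫⁻ q, G (n - j - 1) q ∂Measure.infinitePi (fun _ : ℕ => μ) := by
    intro n
    rw [lintegral_finsetSum]
    · exact Finset.sum_congr rfl fun j _ =>
        lintegral_infinitePi_split μ j (hF j) (hG _) hH (hFj j)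
    · intro j _
      exact ((hF j).mul (hH.comp (measurable_pi_apply j))).mul
        ((hG _).comp (measurable_pi_iff.2 fun i => measurable_pi_apply _))
  simp only [h1, lintegral_offspringLaw]
  rw [tsum_offspring_split (fun j => (∫⁻ q, F j q ∂Measure.infinitePi (fun _ : ℕ => μ))
        * (∫⁻ a, H a ∂μ)) fun j => ∫⁻ q, G j q ∂Measure.infinitePi (fun _ : ℕ => μ)]
  simp only [← mul_assoc, ENNReal.tsum_mul_right]

theorem gwTree_label_nil (x : ℤ) (ω : GWNoise) : (gwTree x ω).label [] = some x := rfl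

theorem gwTree_label_cons (x : ℤ) (ω : GWNoise) (c : ℕ) (u : List ℕ) :
    (gwTree x ω).label (c :: u) = if c < (ω []).1 then
      (gwTree (x + step (ω [c]).2) fun v => ω (c :: v)).label u else none := rfl

theorem gwTree_gwCons_label_cons (x : ℤ) (a : ℕ × Fin 3) (q : ℕ → GWNoise) (c : ℕ)
    (u : List ℕ) : (gwTree x (gwCons a q)).label (c :: u) = if c < a.1 then
      (gwTree (x + step (q c []).2) (q c)).label u else none := rfl

theorem gwTree_congr (x : ℤ) {ω ω' : GWNoise} (h0 : (ω []).1 = (ω' []).1)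
    (h : ∀ c < (ω []).1, ∀ v, ω (c :: v) = ω' (c :: v)) : gwTree x ω = gwTree x ω' := by
  ext1
  funext u
  cases u with
  | nil => rfl
  | cons c u =>
    rw [gwTree_label_cons, gwTree_label_cons, ← h0]
    split_ifs with hc
    · rw [h c hc, funext (h c hc)]
    · rfl

theorem gwTree_shift (x y : ℤ) (ω : GWNoise) : (gwTree x ω).shift y = gwTree (x + y) ω := by
  ext1
  funext u
  induction u generalizing x ω with
  | nil => rfl
  | cons c u ih =>
    have := ih (x + step (ω [c]).2) fun v => ω (c :: v)
    simp only [shift] at this ⊢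
    rw [gwTree_label_cons, gwTree_label_cons, show x + y + step (ω [c]).2
      = x + step (ω [c]).2 + y by ring, ← this]
    split_ifs <;> rfl

@[simp] theorem numChildren_gwTree (x : ℤ) (ω : GWNoise) :
    (gwTree x ω).numChildren [] = (ω []).1 := by
  refine numChildren_eq _ _ _ ?_ fun c hc => ?_
  · simp [gwTree_label_cons]
  · simp [gwTree_label_cons, hc, gwTree_label_nil]

theorem leftR_gwTree (x : ℤ) (n : ℕ) (s : Fin 3) (q : ℕ → GWNoise) (j : ℕ) (hj : j ≤ n) :
    (gwTree x (gwCons (n, s) q)).leftR j = gwTree x (gwCons (j, 0) q) := by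
  ext1
  funext u
  cases u with
  | nil => rfl
  | cons c u =>
    simp only [leftR_label_cons, gwTree_gwCons_label_cons]
    by_cases h : c < j
    · simp [h, lt_of_lt_of_le h hj]
    · simp [h]

theorem childR_gwTree (x : ℤ) (n : ℕ) (s : Fin 3) (q : ℕ → GWNoise) (j : ℕ) (hj : j < n) :
    (gwTree x (gwCons (n, s) q)).childR j = gwTree (x + step (q j []).2) (q j) := by
  ext1
  funext u
  rw [childR_label _ _ (by simpa [gwCons] using hj), gwTree_gwCons_label_cons, if_pos hj]

theorem rightR_gwTree (x : ℤ) (n : ℕ) (s : Fin 3) (q : ℕ → GWNoise) (j : ℕ) :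
    (gwTree x (gwCons (n, s) q)).rightR j
      = gwTree x (gwCons (n - j - 1, 0) fun i => q (i + j + 1)) := by
  ext1
  funext u
  cases u with
  | nil => rfl
  | cons c u =>
    simp only [rightR_label_cons, gwTree_gwCons_label_cons]
    by_cases h : c + j + 1 < n
    · rw [if_pos h, if_pos (by omega)]
    · rw [if_neg h, if_neg (by omega)]

theorem lintegral_GW (x : ℤ) {f : WLTree → ℝ≥0∞} (hf : Measurable f) :
    ∫⁻ t, f t ∂GW x = ∫⁻ ω, f (gwTree x ω) ∂gwNoiseLaw :=
  lintegral_map hf (measurable_gwTree.comp measurable_prodMk_left)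

theorem measurable_gwTree_right (x : ℤ) : Measurable (gwTree x) :=
  measurable_gwTree.comp measurable_prodMk_left

theorem gwTree_gwCons_root (x : ℤ) (n : ℕ) (s : Fin 3) (q : ℕ → GWNoise) :
    gwTree x (gwCons (n, s) q) = gwTree x (gwCons (n, 0) q) :=
  gwTree_congr x rfl fun _ _ _ => rfl

/-- The integral of a function over `μ x'`, for `x'` obtained from `x` by a uniform step. -/
noncomputable def stepAvg (μ : ℤ → Measure WLTree) (x : ℤ) (h : WLTree → ℝ≥0∞) : ℝ≥0∞ :=
  ∫⁻ s, ∫⁻ t, h t ∂μ (x + step s) ∂stepLaw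

/-- The label increment of a child is stored at the root of its own noise, where `gwTree` does not
read it. It is thus independent of the shape and of the increments inside the subtree. -/
theorem lintegral_child_gwNoiseLaw (x : ℤ) {h : WLTree → ℝ≥0∞} (hh : Measurable h) :
    ∫⁻ ω, h (gwTree (x + step (ω []).2) ω) ∂gwNoiseLaw = stepAvg GW x h := by
  have hm : Measurable fun ω : GWNoise => gwTree (x + step (ω []).2) ω :=
    measurable_gwTree.comp (((Measurable.of_discrete (f := fun s => x + step s)).comp
      (measurable_snd.comp (measurable_pi_apply []))).prodMk measurable_id)
  rw [lintegral_gwNoiseLaw (f := fun ω => h (gwTree (x + step (ω []).2) ω)) (hh.comp hm), lintegral_lintegral_swap]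
  · refine lintegral_congr fun s => ?_
    rw [lintegral_GW _ hh, lintegral_gwNoiseLaw_of_root
      (f := fun ω => h (gwTree _ ω)) (hh.comp (measurable_gwTree_right _))]
    · refine lintegral_congr fun n => lintegral_congr fun q => ?_
      rw [gwTree_gwCons_root]
      rfl
    · intro n s' q
      simp only [gwTree_gwCons_root _ n s' q]
  · exact Measurable.aemeasurable (Measurable.of_discrete)

/-- The right factor is a function `G` of the noise and not of the tree. This covers at once a
finite tree and the infinite tree, where what lies to the right of the chosen child also contains
the spine. -/
theorem lintegral_gwNoise_split (x : ℤ) {f h : WLTree → ℝ≥0∞} {G : GWNoise → ℝ≥0∞}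
    (hf : Measurable f) (hh : Measurable h) (hG : Measurable G)
    (hs : ∀ n s q, G (gwCons (n, s) q) = G (gwCons (n, 0) q)) :
    ∫⁻ ω, ∑ j ∈ Finset.range (ω []).1, f ((gwTree x ω).leftR j) * h ((gwTree x ω).childR j)
        * G (gwCons ((ω []).1 - j - 1, 0) fun i v => ω ((i + j + 1) :: v)) ∂gwNoiseLaw
      = (∫⁻ t, f t ∂GW x) * stepAvg GW x h * ∫⁻ ω, G ω ∂gwNoiseLaw := by
  have hc : ∀ n : ℕ, Measurable fun q : ℕ → GWNoise => gwCons (n, 0) q := fun n =>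
    measurable_gwCons.comp measurable_prodMk_left
  have hR : ∀ j : ℕ, Measurable fun (ω : GWNoise) (i : ℕ) (v : List ℕ) => ω ((i + j + 1) :: v) :=
    fun j => measurable_pi_iff.2 fun i => measurable_pi_iff.2 fun v =>
      measurable_pi_apply ((i + j + 1) :: v)
  have hm : Measurable fun ω : GWNoise => ∑ j ∈ Finset.range (ω []).1,
      f ((gwTree x ω).leftR j) * h ((gwTree x ω).childR j)
        * G (gwCons ((ω []).1 - j - 1, 0) fun i v => ω ((i + j + 1) :: v)) := by
    have : Measurable fun p : ℕ × GWNoise => ∑ j ∈ Finset.range p.1,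
        f ((gwTree x p.2).leftR j) * h ((gwTree x p.2).childR j)
          * G (gwCons (p.1 - j - 1, 0) fun i v => p.2 ((i + j + 1) :: v)) :=
      measurable_from_prod_countable_right fun n => by
      refine Finset.measurable_fun_sum (Finset.range n) fun j _ => ?_
      exact
        ((hf.comp ((measurable_leftR j).comp (measurable_gwTree_right x))).mul
          (hh.comp ((measurable_childR j).comp (measurable_gwTree_right x)))).mul
        (hG.comp ((hc (n - j - 1)).comp (hR j)))
    have h0 : Measurable fun ω : GWNoise => (ω []).1 :=
      measurable_fst.comp (measurable_pi_apply [])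
    have h1 := this.comp (h0.prodMk measurable_id)
    simpa only [Function.comp_def, id] using h1
  have hm2 : Measurable fun ω : GWNoise => gwTree (x + step (ω []).2) ω :=
    measurable_gwTree.comp (((Measurable.of_discrete (f := fun s => x + step s)).comp
      (measurable_snd.comp (measurable_pi_apply []))).prodMk measurable_id)
  rw [lintegral_gwNoiseLaw hm, ← lintegral_child_gwNoiseLaw x hh, lintegral_GW x hf,
    lintegral_gwNoiseLaw_of_root (f := fun ω => f (gwTree x ω)) (hf.comp (measurable_gwTree_right x))
      (fun n s q => by simp only [gwTree_gwCons_root x n s q]),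
    lintegral_gwNoiseLaw_of_root hG hs,
    ← lintegral_offspring_split gwNoiseLaw (F := fun n q => f (gwTree x (gwCons (n, 0) q)))
      (G := fun n q => G (gwCons (n, 0) q)) (H := fun ω => h (gwTree (x + step (ω []).2) ω))
      (fun n => hf.comp ((measurable_gwTree_right x).comp (hc n)))
      (fun n => hG.comp (hc n)) (hh.comp hm2)]
  · refine lintegral_congr fun n => ?_
    rw [lintegral_congr (g := fun _ => ∫⁻ q, ∑ j ∈ Finset.range n,
      f (gwTree x (gwCons (j, 0) q)) * h (gwTree (x + step (q j []).2) (q j))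
        * G (gwCons (n - j - 1, 0) fun i => q (i + j + 1))
          ∂Measure.infinitePi (fun _ : ℕ => gwNoiseLaw))]
    · simp
    · intro s
      refine lintegral_congr fun q => Finset.sum_congr rfl fun j hj => ?_
      have hj : j < n := by simpa [gwCons] using hj
      rw [leftR_gwTree x n s q j hj.le, childR_gwTree x n s q j hj]
      rfl
  · intro j q q' hq
    rw [gwTree_congr x (ω := gwCons (j, 0) q) (ω' := gwCons (j, 0) q') rfl]
    intro c hc v
    exact congrFun (hq c hc) v

theorem lintegral_rootSum_GW (x : ℤ) {f h g : WLTree → ℝ≥0∞} (hf : Measurable f)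
    (hh : Measurable h) (hg : Measurable g) :
    ∫⁻ t, rootSum f h g t ∂GW x
      = (∫⁻ t, f t ∂GW x) * stepAvg GW x h * ∫⁻ t, g t ∂GW x := by
  rw [lintegral_GW x (measurable_rootSum hf hh hg), lintegral_GW x hg,
    ← lintegral_gwNoise_split x hf hh (G := fun ω => g (gwTree x ω)) (hg.comp (measurable_gwTree_right x))]
  · refine lintegral_congr fun ω => ?_
    simp only [rootSum, numChildren_gwTree]
    refine Finset.sum_congr rfl fun j _ => ?_
    congr 2
    -- `rightR_gwTree` applies to noises split at the root.
    have hω : ω = gwCons ((ω []).1, (ω []).2) (fun c v => ω (c :: v)) := by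
      funext u
      cases u <;> rfl
    conv_lhs => rw [hω]
    exact rightR_gwTree x _ _ _ j
  · intro n s q
    simp only [gwTree_gwCons_root x n s q]

/-! ### One-step decomposition of the uniform infinite labeled tree -/

/-- The uniform infinite labeled tree with labels translated by `y`. -/
def uniformAt (y : ℤ) (ω : SpineNoise) : WLTree := (uniformTree ω).shift y

theorem measurable_uniformAt (y : ℤ) : Measurable (uniformAt y) :=
  (measurable_shift y).comp measurable_uniformTree

/-- The law of `(T_∞, l_∞ + y)`. -/
noncomputable def uniformLawAt (y : ℤ) : Measure WLTree := uniformLaw.map fun t => t.shift y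

theorem lintegral_uniformLawAt (y : ℤ) {f : WLTree → ℝ≥0∞} (hf : Measurable f) :
    ∫⁻ t, f t ∂uniformLawAt y = ∫⁻ ω, f (uniformAt y ω) ∂spineNoiseLaw := by
  rw [uniformLawAt, uniformLaw, Measure.map_map (measurable_shift y) measurable_uniformTree]
  exact lintegral_map hf (measurable_uniformAt y)

instance (y : ℤ) : IsProbabilityMeasure (uniformLawAt y) :=
  Measure.isProbabilityMeasure_map (measurable_shift y).aemeasurable

theorem spineLabel_succ (S : ℕ → ℤ) (L R : ℕ → WLTree) (i : ℕ) (u : List ℕ) :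
    spineLabel S L R (i + 1) u
      = spineLabel (fun i => S (i + 1)) (fun i => L (i + 1)) (fun i => R (i + 1)) i u := by
  induction u generalizing i with
  | nil => rfl
  | cons c u ih => simp only [spineLabel, ih]

theorem spineLabel_map_add (S : ℕ → ℤ) (L R : ℕ → WLTree) (i : ℕ) (u : List ℕ) (y : ℤ) :
    (spineLabel S L R i u).map (· + y)
      = spineLabel (fun i => S i + y) (fun i => (L i).shift y) (fun i => (R i).shift y) i u := by
  induction u generalizing i with
  | nil => rfl
  | cons c u ih =>
    simp only [spineLabel, numChildren_shift]
    split_ifs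
    · rfl
    · exact ih _
    · rfl

theorem spineWalk_seqCons_succ (a : Fin 3 × GWNoise × GWNoise) (ω : SpineNoise) (i : ℕ) :
    spineWalk (seqCons a ω) (i + 1) = spineWalk ω i + step a.1 := by
  simp [spineWalk, Finset.sum_range_succ', seqCons]

theorem uniformAt_label (y : ℤ) (ω : SpineNoise) (u : List ℕ) :
    (uniformAt y ω).label u = spineLabel (fun i => spineWalk ω i + y)
      (fun i => gwTree (spineWalk ω i + y) (ω i).2.1)
      (fun i => gwTree (spineWalk ω i + y) (ω i).2.2) 0 u := by
  have := spineLabel_map_add (spineWalk ω) (fun i => gwTree (spineWalk ω i) (ω i).2.1)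
    (fun i => gwTree (spineWalk ω i) (ω i).2.2) 0 u y
  simp only [gwTree_shift] at this
  exact this

theorem uniformAt_label_nil (y : ℤ) (ω : SpineNoise) :
    (uniformAt y ω).label [] = some y := by
  simp [uniformAt_label, spineLabel, spineWalk]

/-- Self-similarity: the subtree of the spine child is again an infinite tree of the same kind,
translated by the first step. Inductions along the spine use this instead of `spineLabel`. -/
theorem uniformAt_label_cons (y : ℤ) (s : Fin 3) (ωL ωR : GWNoise) (ω : SpineNoise) (c : ℕ)
    (u : List ℕ) : (uniformAt y (seqCons (s, ωL, ωR) ω)).label (c :: u)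
      = if c < (ωL []).1 then (gwTree y ωL).label (c :: u)
        else if c = (ωL []).1 then (uniformAt (y + step s) ω).label u
        else (gwTree y ωR).label ((c - (ωL []).1 - 1) :: u) := by
  have h0 : spineWalk (seqCons (s, ωL, ωR) ω) 0 + y = y := by simp [spineWalk]
  simp only [uniformAt_label, spineLabel, numChildren_gwTree, h0, spineLabel_succ,
    spineWalk_seqCons_succ, add_assoc, add_comm (step s) y]
  rfl

theorem numChildren_uniformAt (y : ℤ) (s : Fin 3) (ωL ωR : GWNoise) (ω : SpineNoise) :
    (uniformAt y (seqCons (s, ωL, ωR) ω)).numChildren [] = (ωL []).1 + (1 + (ωR []).1) := by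
  refine numChildren_eq _ _ _ ?_ fun c hc => ?_
  · rw [List.nil_append, uniformAt_label_cons, if_neg (by omega), if_neg (by omega),
      gwTree_label_cons, if_neg (by omega)]
  · rw [List.nil_append, uniformAt_label_cons]
    split_ifs with h1 h2
    · simp [gwTree_label_cons, h1, gwTree_label_nil]
    · simp [uniformAt_label_nil]
    · rw [gwTree_label_cons, if_pos (by omega), gwTree_label_nil]
      simp

/-- For a child to the left of the spine, the right part keeps the spine: it is an infinite tree
whose first left noise has lost the children up to `j`. -/
theorem uniformAt_left (y : ℤ) (s : Fin 3) (ωL ωR : GWNoise) (ω : SpineNoise) (j : ℕ)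
    (hj : j < (ωL []).1) :
    (uniformAt y (seqCons (s, ωL, ωR) ω)).leftR j = (gwTree y ωL).leftR j ∧
    (uniformAt y (seqCons (s, ωL, ωR) ω)).childR j = (gwTree y ωL).childR j ∧
    (uniformAt y (seqCons (s, ωL, ωR) ω)).rightR j = uniformAt y (seqCons
      (s, gwCons ((ωL []).1 - j - 1, 0) (fun i v => ωL ((i + j + 1) :: v)), ωR) ω) := by
  refine ⟨?_, ?_, ?_⟩
  · ext1
    funext u
    cases u with
    | nil => exact uniformAt_label_nil _ _
    | cons c u =>
      simp only [leftR_label_cons]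
      split_ifs with h
      · rw [uniformAt_label_cons, if_pos (by omega)]
      · rfl
  · ext1
    funext u
    rw [childR_label _ _ (by rw [numChildren_uniformAt]; omega), childR_label _ _ (by simpa),
      uniformAt_label_cons, if_pos hj]
  · ext1
    funext u
    cases u with
    | nil => rw [rightR_label_nil, uniformAt_label_nil, uniformAt_label_nil]
    | cons c u =>
      simp only [rightR_label_cons, uniformAt_label_cons, gwTree_label_cons]
      have hroot : ∀ (a : ℕ × Fin 3) (q : ℕ → GWNoise), gwCons a q [] = a := fun _ _ => rfl
      simp only [hroot]
      by_cases h1 : c + j + 1 < (ωL []).1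
      · rw [if_pos h1, if_pos h1, if_pos (show c < (ωL []).1 - j - 1 by omega),
          if_pos (show c < (ωL []).1 - j - 1 by omega)]
        rfl
      · rw [if_neg h1, if_neg (show ¬ c < (ωL []).1 - j - 1 by omega)]
        by_cases h2 : c + j + 1 = (ωL []).1
        · rw [if_pos h2, if_pos (show c = (ωL []).1 - j - 1 by omega)]
        · rw [if_neg h2, if_neg (show ¬ c = (ωL []).1 - j - 1 by omega),
            show c + j + 1 - (ωL []).1 - 1 = c - ((ωL []).1 - j - 1) - 1 by omega]

theorem uniformAt_spine (y : ℤ) (s : Fin 3) (ωL ωR : GWNoise) (ω : SpineNoise) :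
    (uniformAt y (seqCons (s, ωL, ωR) ω)).leftR (ωL []).1 = gwTree y ωL ∧
    (uniformAt y (seqCons (s, ωL, ωR) ω)).childR (ωL []).1 = uniformAt (y + step s) ω ∧
    (uniformAt y (seqCons (s, ωL, ωR) ω)).rightR (ωL []).1 = gwTree y ωR := by
  refine ⟨?_, ?_, ?_⟩
  · ext1
    funext u
    cases u with
    | nil => exact uniformAt_label_nil _ _
    | cons c u =>
      simp only [leftR_label_cons, uniformAt_label_cons]
      by_cases h : c < (ωL []).1
      · simp [h]
      · simp [h, gwTree_label_cons]
  · ext1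
    funext u
    rw [childR_label _ _ (by rw [numChildren_uniformAt]; omega), uniformAt_label_cons,
      if_neg (lt_irrefl _), if_pos rfl]
  · ext1
    funext u
    cases u with
    | nil => exact uniformAt_label_nil _ _
    | cons c u =>
      rw [rightR_label_cons, uniformAt_label_cons, if_neg (by omega), if_neg (by omega),
        show c + (ωL []).1 + 1 - (ωL []).1 - 1 = c by omega]

/-! ### Finite and infinite trees -/

namespace WLTree

theorem infinite_of_cons (t : WLTree) (j : ℕ) (h : {u | j :: u ∈ t.vertices}.Infinite) :
    t.vertices.Infinite := by
  intro hf
  exact h (hf.preimage (f := fun u => j :: u) (List.cons_injective.injOn))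

end WLTree

theorem exists_mem_uniformAt (n : ℕ) (y : ℤ) (ω : SpineNoise) :
    ∃ u ∈ (uniformAt y ω).vertices, u.length = n := by
  induction n generalizing y ω with
  | zero => exact ⟨[], WLTree.root_mem _, rfl⟩
  | succ n ih =>
    have hω : ω = seqCons ((ω 0).1, (ω 0).2.1, (ω 0).2.2) (fun i => ω (i + 1)) := by
      funext i
      cases i <;> rfl
    obtain ⟨u, hu, hn⟩ := ih (y + step (ω 0).1) fun i => ω (i + 1)
    refine ⟨((ω 0).2.1 []).1 :: u, ?_, by simp [hn]⟩
    have := uniformAt_label_cons y (ω 0).1 (ω 0).2.1 (ω 0).2.2 (fun i => ω (i + 1))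
      ((ω 0).2.1 []).1 u
    rw [← hω, if_neg (lt_irrefl _), if_pos rfl] at this
    simp only [vertices, Set.mem_ofPred_eq] at hu ⊢
    rwa [this]

theorem infinite_uniformAt (y : ℤ) (ω : SpineNoise) : (uniformAt y ω).vertices.Infinite := by
  intro hf
  have h : (List.length '' (uniformAt y ω).vertices).Finite := hf.image _
  refine Set.infinite_univ (h.subset fun n _ => ?_)
  obtain ⟨u, hu, hn⟩ := exists_mem_uniformAt n y ω
  exact ⟨u, hu, hn⟩

/-- To the right of the spine child, the left part contains the spine. Such children drop out of any
sum whose left factor vanishes on infinite trees. -/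
theorem infinite_leftR_uniformAt (y : ℤ) (s : Fin 3) (ωL ωR : GWNoise) (ω : SpineNoise) (j : ℕ)
    (hj : (ωL []).1 < j) :
    ((uniformAt y (seqCons (s, ωL, ωR) ω)).leftR j).vertices.Infinite := by
  refine infinite_of_cons _ (ωL []).1 ?_
  convert infinite_uniformAt (y + step s) ω using 2
  ext u
  simp only [vertices, Set.mem_ofPred_eq, leftR_label_cons, if_pos hj]
  rw [uniformAt_label_cons, if_neg (lt_irrefl _), if_pos rfl]

/-- The left noise is integrated innermost so that `lintegral_gwNoise_split` can be used with all
other components fixed. -/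
theorem lintegral_spineNoiseLaw {f : SpineNoise → ℝ≥0∞} (hf : Measurable f) :
    ∫⁻ ω, f ω ∂spineNoiseLaw = ∫⁻ s, ∫⁻ ω, ∫⁻ ωR, ∫⁻ ωL, f (seqCons (s, ωL, ωR) ω)
      ∂gwNoiseLaw ∂gwNoiseLaw ∂spineNoiseLaw ∂stepLaw := by
  have h0 : Measurable fun p : (Fin 3 × GWNoise × GWNoise) × SpineNoise => f (seqCons p.1 p.2) :=
    hf.comp measurable_seqCons
  unfold spineNoiseLaw
  rw [lintegral_infinitePi_seqCons _ hf, lintegral_prod _ h0.lintegral_prod_right'.aemeasurable]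
  refine lintegral_congr fun s => ?_
  have h1 : Measurable fun p : (GWNoise × GWNoise) × SpineNoise => f (seqCons (s, p.1) p.2) :=
    h0.comp ((measurable_prodMk_left.comp measurable_fst).prodMk measurable_snd)
  rw [lintegral_lintegral_swap h1.aemeasurable]
  refine lintegral_congr fun ω => ?_
  have h2 : Measurable fun p : GWNoise × GWNoise => f (seqCons (s, p) ω) :=
    h1.comp measurable_prodMk_right
  exact lintegral_prod_symm _ h2.aemeasurable

theorem lintegral_uniformLawAt_split (y : ℤ) {f : WLTree → ℝ≥0∞} (hf : Measurable f) :
    ∫⁻ t, f t ∂uniformLawAt y = ∫⁻ s, ∫⁻ ω, ∫⁻ ωR, ∫⁻ ωL,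
      f (uniformAt y (seqCons (s, ωL, ωR) ω))
      ∂gwNoiseLaw ∂gwNoiseLaw ∂spineNoiseLaw ∂stepLaw := by
  rw [lintegral_uniformLawAt y hf]
  exact lintegral_spineNoiseLaw (f := fun ω => f (uniformAt y ω))
    (hf.comp (measurable_uniformAt y))

theorem uniformAt_seqCons_root (y : ℤ) (s : Fin 3) (n : ℕ) (a : Fin 3) (q : ℕ → GWNoise)
    (ωR : GWNoise) (ω : SpineNoise) : uniformAt y (seqCons (s, gwCons (n, a) q, ωR) ω)
      = uniformAt y (seqCons (s, gwCons (n, 0) q, ωR) ω) := by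
  ext1
  funext u
  cases u with
  | nil => rw [uniformAt_label_nil, uniformAt_label_nil]
  | cons c u => rw [uniformAt_label_cons, uniformAt_label_cons]; rfl

/-- The two terms correspond to the position of the spine: to the right of the chosen child (the
right part is infinite), or through it (the subtree of the child is infinite). `hinf` removes the
third position. -/
theorem lintegral_rootSum_uniformLawAt (y : ℤ) {f h g : WLTree → ℝ≥0∞} (hf : Measurable f)
    (hh : Measurable h) (hg : Measurable g)
    (hinf : ∀ t : WLTree, t.vertices.Infinite → f t = 0) :
    ∫⁻ t, rootSum f h g t ∂uniformLawAt y
      = (∫⁻ t, f t ∂GW y) * stepAvg GW y h * (∫⁻ t, g t ∂uniformLawAt y)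
        + (∫⁻ t, f t ∂GW y) * stepAvg uniformLawAt y h * ∫⁻ t, g t ∂GW y := by
  have hsplit : ∀ s ω ωR ωL, rootSum f h g (uniformAt y (seqCons (s, ωL, ωR) ω))
      = (∑ j ∈ Finset.range (ωL []).1, f ((gwTree y ωL).leftR j) * h ((gwTree y ωL).childR j)
          * g (uniformAt y (seqCons (s, gwCons ((ωL []).1 - j - 1, 0)
            (fun i v => ωL ((i + j + 1) :: v)), ωR) ω)))
        + f (gwTree y ωL) * h (uniformAt (y + step s) ω) * g (gwTree y ωR) := by
    intro s ω ωR ωL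
    rw [rootSum, numChildren_uniformAt, Finset.sum_range_add, Finset.sum_range_add]
    congr 1
    · refine Finset.sum_congr rfl fun j hj => ?_
      obtain ⟨h1, h2, h3⟩ := uniformAt_left y s ωL ωR ω j (Finset.mem_range.1 hj)
      rw [h1, h2, h3]
    · obtain ⟨h1, h2, h3⟩ := uniformAt_spine y s ωL ωR ω
      rw [Finset.sum_range_one, add_zero, h1, h2, h3, Finset.sum_eq_zero, add_zero]
      intro j _
      rw [hinf _ (infinite_leftR_uniformAt y s ωL ωR ω _ (by omega)), zero_mul, zero_mul]
  have hcons : ∀ s ω ωR, Measurable fun ωL : GWNoise => uniformAt y (seqCons (s, ωL, ωR) ω) :=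
    fun s ω ωR => (measurable_uniformAt y).comp (measurable_seqCons.comp
      (((measurable_const (a := s)).prodMk
        (measurable_id.prodMk (measurable_const (a := ωR)))).prodMk (measurable_const (a := ω))))
  have hgw := measurable_gwTree_right y
  have hin : ∀ s ω ωR, ∫⁻ ωL, rootSum f h g (uniformAt y (seqCons (s, ωL, ωR) ω)) ∂gwNoiseLaw
      = (∫⁻ t, f t ∂GW y) * stepAvg GW y h
          * (∫⁻ ωL, g (uniformAt y (seqCons (s, ωL, ωR) ω)) ∂gwNoiseLaw)
        + (∫⁻ t, f t ∂GW y) * h (uniformAt (y + step s) ω) * g (gwTree y ωR) := by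
    intro s ω ωR
    simp only [hsplit]
    have hfgw : Measurable fun ωL : GWNoise => f (gwTree y ωL) := hf.comp hgw
    rw [lintegral_add_right _ ((hfgw.mul_const _).mul_const _)]
    congr 1
    · exact lintegral_gwNoise_split y hf hh (hg.comp (hcons s ω ωR))
        fun n a q => by simp only [Function.comp, uniformAt_seqCons_root y s n a q]
    · rw [lintegral_mul_const _ (hfgw.mul_const _), lintegral_mul_const _ hfgw,
        lintegral_GW y hf]
  rw [lintegral_uniformLawAt_split y (measurable_rootSum hf hh hg),
    lintegral_uniformLawAt_split y hg]
  simp only [hin]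
  have hb : Measurable fun p : ((Fin 3 × SpineNoise) × GWNoise) × GWNoise =>
      g (uniformAt y (seqCons (p.1.1.1, p.2, p.1.2) p.1.1.2)) := by
    have h1 : Measurable fun p : ((Fin 3 × SpineNoise) × GWNoise) × GWNoise =>
        (p.1.1.1, p.2, p.1.2) := by fun_prop
    have h2 : Measurable fun p : ((Fin 3 × SpineNoise) × GWNoise) × GWNoise => p.1.1.2 := by
      fun_prop
    exact hg.comp ((measurable_uniformAt y).comp (measurable_seqCons.comp (h1.prodMk h2)))
  -- From here on, only the joint measurability of this integrand matters.
  obtain ⟨K, hK⟩ : ∃ K : Fin 3 → SpineNoise → GWNoise → GWNoise → ℝ≥0∞,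
      K = fun s ω ωR ωL => g (uniformAt y (seqCons (s, ωL, ωR) ω)) := ⟨_, rfl⟩
  have hK' : ∀ s ω ωR ωL, g (uniformAt y (seqCons (s, ωL, ωR) ω)) = K s ω ωR ωL := fun _ _ _ _ => by
    rw [hK]
  simp only [hK'] at hb ⊢
  clear hsplit hcons hin hK hK'
  have hb1 := hb.lintegral_prod_right' (ν := gwNoiseLaw)
  have hb2 := hb1.lintegral_prod_right' (ν := gwNoiseLaw)
  have hggw : Measurable fun ωR : GWNoise => g (gwTree y ωR) := hg.comp hgw
  have hhu : ∀ s, Measurable fun ω : SpineNoise => h (uniformAt (y + step s) ω) := fun s =>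
    hh.comp (measurable_uniformAt _)
  set A := ∫⁻ t, f t ∂GW y
  set B := stepAvg GW y h
  have hR : ∀ s ω, ∫⁻ ωR, (A * B * (∫⁻ ωL, K s ω ωR ωL ∂gwNoiseLaw)
        + A * h (uniformAt (y + step s) ω) * g (gwTree y ωR)) ∂gwNoiseLaw
      = A * B * (∫⁻ ωR, ∫⁻ ωL, K s ω ωR ωL ∂gwNoiseLaw ∂gwNoiseLaw)
        + A * h (uniformAt (y + step s) ω) * ∫⁻ t, g t ∂GW y := by
    intro s ω
    have hb1' : Measurable fun ωR =>
        ∫⁻ ωL, K s ω ωR ωL ∂gwNoiseLaw :=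
      hb1.comp (measurable_prodMk_left (x := (s, ω)))
    rw [lintegral_add_right _ (hggw.const_mul _), lintegral_const_mul _ hggw, lintegral_GW y hg,
      lintegral_const_mul _ hb1']
  have hS : ∀ s, ∫⁻ ω, (A * B * (∫⁻ ωR, ∫⁻ ωL, K s ω ωR ωL
          ∂gwNoiseLaw ∂gwNoiseLaw)
        + A * h (uniformAt (y + step s) ω) * ∫⁻ t, g t ∂GW y) ∂spineNoiseLaw
      = A * B * (∫⁻ ω, ∫⁻ ωR, ∫⁻ ωL, K s ω ωR ωL
          ∂gwNoiseLaw ∂gwNoiseLaw ∂spineNoiseLaw)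
        + A * (∫⁻ t, h t ∂uniformLawAt (y + step s)) * ∫⁻ t, g t ∂GW y := by
    intro s
    have hb2' : Measurable fun ω : SpineNoise => ∫⁻ ωR, ∫⁻ ωL,
        K s ω ωR ωL ∂gwNoiseLaw ∂gwNoiseLaw :=
      hb2.comp (measurable_prodMk_left (x := s))
    rw [lintegral_add_right _ (((hhu s).const_mul _).mul_const _),
      lintegral_mul_const _ ((hhu s).const_mul _), lintegral_const_mul _ (hhu s),
      lintegral_uniformLawAt _ hh,
      lintegral_const_mul _ hb2']
  simp only [hR, hS]
  rw [lintegral_add_left Measurable.of_discrete, lintegral_const_mul _ Measurable.of_discrete,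
    lintegral_mul_const _ Measurable.of_discrete, lintegral_const_mul _ Measurable.of_discrete]
  rfl

/-! ### Sums over branches -/

/-- The sum, over the vertices `v` at height `m`, of the product of `g 0` of the tree of
descendants of `v` and of the `f i` (`g i`) of the subtrees attached to the left (to the right) of
the branch at the `i`-th ancestor of `v`. -/
noncomputable def branchSum (f g : ℕ → WLTree → ℝ≥0∞) : ℕ → WLTree → ℝ≥0∞
  | 0 => g 0
  | m + 1 => rootSum (f (m + 1)) (branchSum f g m) (g (m + 1))

theorem measurable_branchSum {f g : ℕ → WLTree → ℝ≥0∞} (hf : ∀ i, Measurable (f i))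
    (hg : ∀ i, Measurable (g i)) (m : ℕ) : Measurable (branchSum f g m) := by
  induction m with
  | zero => exact hg 0
  | succ m ih => exact measurable_rootSum (hf _) ih (hg _)

/-- A branch sum whose factors prescribe root labels sees only trees of root label `x m`, so a
single value of each label step contributes. -/
theorem branchSum_eq_zero {f g : ℕ → WLTree → ℝ≥0∞} {x : ℕ → ℤ}
    (hf : ∀ i t, t.label [] ≠ some (x (i + 1)) → f (i + 1) t = 0)
    (hg : ∀ t, t.label [] ≠ some (x 0) → g 0 t = 0) (m : ℕ) (t : WLTree)
    (ht : t.label [] ≠ some (x m)) : branchSum f g m t = 0 := by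
  cases m with
  | zero => exact hg t ht
  | succ m =>
    unfold branchSum rootSum
    refine Finset.sum_eq_zero fun j _ => ?_
    rw [hf m _ (by simpa using ht), zero_mul, zero_mul]

theorem lintegral_GW_eq_zero {x y : ℤ} (hxy : x ≠ y) {h : WLTree → ℝ≥0∞} (hm : Measurable h)
    (hh : ∀ t, t.label [] ≠ some x → h t = 0) : ∫⁻ t, h t ∂GW y = 0 := by
  rw [lintegral_GW y hm]
  simp [hh _ (show (gwTree y _).label [] ≠ some x by simpa [gwTree_label_nil] using hxy.symm)]

theorem lintegral_uniformLawAt_eq_zero {x y : ℤ} (hxy : x ≠ y) {h : WLTree → ℝ≥0∞}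
    (hm : Measurable h) (hh : ∀ t, t.label [] ≠ some x → h t = 0) :
    ∫⁻ t, h t ∂uniformLawAt y = 0 := by
  rw [lintegral_uniformLawAt y hm]
  simp [hh _ (show (uniformAt y _).label [] ≠ some x by
    simpa [uniformAt_label_nil] using hxy.symm)]

theorem lintegral_stepLaw (f : Fin 3 → ℝ≥0∞) :
    ∫⁻ s, f s ∂stepLaw = 3⁻¹ * (f 0 + f 1 + f 2) := by
  rw [lintegral_fintype]
  have : ∀ s, stepLaw {s} = 3⁻¹ := fun s => by
    rw [stepLaw, PMF.toMeasure_apply_singleton _ _ (measurableSet_singleton s)]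
    simp
  simp only [this, Fin.sum_univ_three, ← add_mul]
  rw [mul_comm]

theorem stepAvg_eq (μ : ℤ → Measure WLTree) (x : ℤ) (h : WLTree → ℝ≥0∞) :
    stepAvg μ x h = 3⁻¹ * ((∫⁻ t, h t ∂μ (x - 1)) + (∫⁻ t, h t ∂μ x) + ∫⁻ t, h t ∂μ (x + 1)) := by
  simp [stepAvg, lintegral_stepLaw, step, sub_eq_add_neg]

/-- Among the three equally likely labels of the child only `z` contributes; this is the origin of
the powers of `1/3`. -/
theorem stepAvg_of_eq_zero {μ : ℤ → Measure WLTree} {x z : ℤ} {h : WLTree → ℝ≥0∞}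
    (hz : |x - z| ≤ 1) (hμ : ∀ y, z ≠ y → ∫⁻ t, h t ∂μ y = 0) :
    stepAvg μ x h = 3⁻¹ * ∫⁻ t, h t ∂μ z := by
  rw [stepAvg_eq]
  obtain ⟨h1, h2⟩ := abs_le.1 hz
  obtain rfl | rfl | rfl : x = z - 1 ∨ x = z ∨ x = z + 1 := by omega
  · rw [hμ _ (by omega), hμ (z - 1) (by omega)]
    simp
  · rw [hμ _ (by omega), hμ (x + 1) (by omega)]
    simp
  · rw [hμ (z + 1) (by omega), hμ (z + 1 + 1) (by omega)]
    simp

section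

variable {f g : ℕ → WLTree → ℝ≥0∞} {x : ℕ → ℤ}

theorem lintegral_branchSum_GW (hfm : ∀ i, Measurable (f i)) (hgm : ∀ i, Measurable (g i))
    (hf : ∀ i t, t.label [] ≠ some (x (i + 1)) → f (i + 1) t = 0)
    (hg : ∀ t, t.label [] ≠ some (x 0) → g 0 t = 0) (m : ℕ)
    (hx : ∀ i < m, |x (i + 1) - x i| ≤ 1) :
    ∫⁻ t, branchSum f g m t ∂GW (x m)
      = 3⁻¹ ^ m * (∏ i ∈ Finset.range m, ∫⁻ t, f (i + 1) t ∂GW (x (i + 1)))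
        * ∏ i ∈ Finset.range (m + 1), ∫⁻ t, g i t ∂GW (x i) := by
  induction m with
  | zero => simp [branchSum]
  | succ m ih =>
    have hm := measurable_branchSum hfm hgm m
    rw [branchSum, lintegral_rootSum_GW _ (hfm _) hm (hgm _), stepAvg_of_eq_zero
      (hx m (Nat.lt_succ_self m)) fun y hy => lintegral_GW_eq_zero hy hm
        (branchSum_eq_zero hf hg m), ih fun i hi => hx i (by omega),
      Finset.prod_range_succ _ (m + 1),
      Finset.prod_range_succ (fun i => ∫⁻ t, f (i + 1) t ∂GW (x (i + 1))) m, pow_succ]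
    ring

/-- `I` records the position of the infinite part. At each new level it is the new right part (`I =
m + 1`, with a Galton–Watson tree below, handled by `lintegral_branchSum_GW`) or it lies further
along the branch (`I ≤ m`, by induction). -/
theorem lintegral_branchSum_uniformLawAt (hfm : ∀ i, Measurable (f i))
    (hgm : ∀ i, Measurable (g i))
    (hf : ∀ i t, t.label [] ≠ some (x (i + 1)) → f (i + 1) t = 0)
    (hinf : ∀ i t, t.vertices.Infinite → f (i + 1) t = 0)
    (hg : ∀ t, t.label [] ≠ some (x 0) → g 0 t = 0) (m : ℕ)
    (hx : ∀ i < m, |x (i + 1) - x i| ≤ 1) :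
    ∫⁻ t, branchSum f g m t ∂uniformLawAt (x m)
      = 3⁻¹ ^ m * (∏ i ∈ Finset.range m, ∫⁻ t, f (i + 1) t ∂GW (x (i + 1)))
        * ∑ I ∈ Finset.range (m + 1), ∏ i ∈ Finset.range (m + 1),
          if i = I then ∫⁻ t, g i t ∂uniformLawAt (x i) else ∫⁻ t, g i t ∂GW (x i) := by
  induction m with
  | zero => simp [branchSum]
  | succ m ih =>
    have hm := measurable_branchSum hfm hgm m
    have hx' : ∀ i < m, |x (i + 1) - x i| ≤ 1 := fun i hi => hx i (by omega)
    have hstep := hx m (Nat.lt_succ_self m)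
    have hsum : (∑ I ∈ Finset.range (m + 1), ∏ i ∈ Finset.range (m + 1 + 1),
          if i = I then ∫⁻ t, g i t ∂uniformLawAt (x i) else ∫⁻ t, g i t ∂GW (x i))
        = (∑ I ∈ Finset.range (m + 1), ∏ i ∈ Finset.range (m + 1),
          if i = I then ∫⁻ t, g i t ∂uniformLawAt (x i) else ∫⁻ t, g i t ∂GW (x i))
          * ∫⁻ t, g (m + 1) t ∂GW (x (m + 1)) := by
      rw [Finset.sum_mul]
      refine Finset.sum_congr rfl fun I hI => ?_
      rw [Finset.prod_range_succ,
        if_neg (show ¬ m + 1 = I by have := Finset.mem_range.1 hI; omega)]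
    rw [branchSum, lintegral_rootSum_uniformLawAt _ (hfm _) hm (hgm _) (hinf m),
      stepAvg_of_eq_zero hstep fun y hy => lintegral_GW_eq_zero hy hm
        (branchSum_eq_zero hf hg m),
      stepAvg_of_eq_zero hstep fun y hy => lintegral_uniformLawAt_eq_zero hy hm
        (branchSum_eq_zero hf hg m), ih hx', lintegral_branchSum_GW hfm hgm hf hg m hx',
      Finset.sum_range_succ _ (m + 1), Finset.prod_range_succ _ (m + 1), if_pos rfl,
      Finset.prod_congr rfl fun i (hi : i ∈ Finset.range (m + 1)) => if_neg
        (show ¬ i = m + 1 by have := Finset.mem_range.1 hi; omega), hsum,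
      Finset.prod_range_succ (fun i => ∫⁻ t, f (i + 1) t ∂GW (x (i + 1))) m, pow_succ]
    ring

end

/-! ### Branches satisfying constraints -/

/-- The vertex `v` is at height `m`, the subtrees attached to the left (to the right) of the branch
from the root to `v` at the `i`-th ancestor of `v` belong to `A i` (to `B i`), and the tree of
descendants of `v` belongs to `B 0`. -/
def IsBranch (A B : ℕ → Set WLTree) : ℕ → WLTree → List ℕ → Prop
  | 0, t, [] => t ∈ B 0
  | 0, _, _ :: _ => False
  | _ + 1, _, [] => False
  | m + 1, t, j :: v => j < t.numChildren [] ∧ t.leftR j ∈ A (m + 1) ∧ t.rightR j ∈ B (m + 1) ∧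
      IsBranch A B m (t.childR j) v

theorem IsBranch.label {A B : ℕ → Set WLTree} (hB : B 0 ⊆ {t | t.label [] = some 0}) {m : ℕ}
    {t : WLTree} {v : List ℕ} (h : IsBranch A B m t v) : t.label v = some 0 := by
  induction m generalizing t v with
  | zero =>
    cases v with
    | nil => exact hB h
    | cons j v => exact h.elim
  | succ m ih =>
    cases v with
    | nil => exact h.elim
    | cons j v =>
      obtain ⟨hj, -, -, h⟩ := h
      rw [← childR_label t j hj]
      exact ih h

/-- The set of trees with positive labels. -/
def positiveTrees : Set WLTree := {t | ∀ u a, t.label u = some a → 0 < a}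

/-- If the second branch left the root further to the right, the endpoint of the first one, of label
`0`, would lie in a left tree with positive labels. -/
theorem IsBranch.index_le {A B : ℕ → Set WLTree} (hB : B 0 ⊆ {t | t.label [] = some 0})
    (hA : ∀ i, A (i + 1) ⊆ positiveTrees) {m : ℕ} {t : WLTree} {j j' : ℕ} {v v' : List ℕ}
    (h : IsBranch A B (m + 1) t (j :: v)) (h' : IsBranch A B (m + 1) t (j' :: v')) : j' ≤ j := by
  by_contra hlt
  have h0 := h.label hB
  have := hA m h'.2.1 (j :: v) 0 (by rw [leftR_label_cons, if_pos (not_le.1 hlt), h0])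
  exact lt_irrefl _ this

/-- By `IsBranch.index_le` at most one child contributes at each level, so counting the admissible
vertices is the same as testing for their existence. -/
theorem branchSum_indicator {A B : ℕ → Set WLTree} (hB : B 0 ⊆ {t | t.label [] = some 0})
    (hA : ∀ i, A (i + 1) ⊆ positiveTrees) (m : ℕ) (t : WLTree) :
    branchSum (fun i => (A i).indicator 1) (fun i => (B i).indicator 1) m t
      = {t | ∃ v, IsBranch A B m t v}.indicator 1 t := by
  classical
  induction m generalizing t with
  | zero =>
    have : (∃ v, IsBranch A B 0 t v) ↔ t ∈ B 0 := by
      refine ⟨?_, fun h => ⟨[], h⟩⟩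
      rintro ⟨_ | ⟨j, v⟩, h⟩
      · exact h
      · exact h.elim
    by_cases h : t ∈ B 0 <;> simp [branchSum, Set.indicator, this, h]
  | succ m ih =>
    have hterm : ∀ j ∈ Finset.range (t.numChildren []),
        (A (m + 1)).indicator 1 (t.leftR j)
          * branchSum (fun i => (A i).indicator 1) (fun i => (B i).indicator 1) m (t.childR j)
          * (B (m + 1)).indicator 1 (t.rightR j)
        = if ∃ v, IsBranch A B (m + 1) t (j :: v) then (1 : ℝ≥0∞) else 0 := by
      intro j hj
      have hj := Finset.mem_range.1 hj
      simp only [ih, IsBranch, hj, true_and, exists_and_left, Set.indicator_apply,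
        Set.mem_ofPred_eq, Pi.one_apply]
      by_cases h1 : t.leftR j ∈ A (m + 1) <;> by_cases h2 : t.rightR j ∈ B (m + 1) <;> simp [h1, h2]
    simp only [branchSum, rootSum]
    rw [Finset.sum_congr rfl hterm]
    by_cases h : ∃ v, IsBranch A B (m + 1) t v
    · rw [Set.indicator_of_mem (show t ∈ {t | ∃ v, IsBranch A B (m + 1) t v} from h)]
      obtain ⟨_ | ⟨j, v⟩, hv⟩ := h
      · exact hv.elim
      · rw [Finset.sum_eq_single j, if_pos ⟨v, hv⟩]
        · rfl
        · rintro j' - hne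
          rw [if_neg]
          rintro ⟨v', hv'⟩
          exact hne (le_antisymm (hv.index_le hB hA hv') (hv'.index_le hB hA hv))
        · intro hj
          exact absurd (Finset.mem_range.2 hv.1) hj
    · rw [Set.indicator_of_notMem (show t ∉ {t | ∃ v, IsBranch A B (m + 1) t v} from h)]
      refine Finset.sum_eq_zero fun j _ => if_neg ?_
      rintro ⟨v, hv⟩
      exact h ⟨_, hv⟩

namespace WLTree

/-! ### Exploration of the corners -/

/-- The vertex `z` is a strict ancestor of `v`, or precedes `v` in depth-first order without being
an ancestor of `v`. -/
def Precedes (z v : List ℕ) : Prop :=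
  ∃ w d s, v = w ++ d :: s ∧ (z = w ∨ ∃ e < d, ∃ r, z = w ++ e :: r)

theorem Precedes.ne {z v : List ℕ} (h : Precedes z v) : z ≠ v := by
  obtain ⟨w, d, s, rfl, rfl | ⟨e, he, r, rfl⟩⟩ := h
  · simp
  · simp [he.ne]

theorem Precedes.append {z v : List ℕ} (h : Precedes z v) (u : List ℕ) : Precedes z (v ++ u) := by
  obtain ⟨w, d, s, rfl, h⟩ := h
  exact ⟨w, d, s ++ u, by simp, h⟩

/-- A corner `(v, j)` is read as the word `v ++ [j]`; what precedes that word is exactly what the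
exploration should have visited up to this corner. -/
theorem precedes_append_singleton {z v : List ℕ} {j : ℕ} :
    Precedes z (v ++ [j]) ↔ Precedes z v ∨ z = v ∨ ∃ e < j, ∃ r, z = v ++ e :: r := by
  constructor
  · rintro ⟨w, d, s, hv, h⟩
    rcases List.eq_nil_or_concat s with rfl | ⟨s, c, rfl⟩
    · obtain ⟨rfl, h'⟩ := List.append_inj' hv rfl
      obtain rfl : j = d := by simpa using h'
      exact Or.inr h
    · have hv' : v ++ [j] = (w ++ d :: s) ++ [c] := by simpa using hv
      obtain ⟨rfl, -⟩ := List.append_inj' hv' rfl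
      exact Or.inl ⟨w, d, s, rfl, h⟩
  · rintro (h | h)
    · exact h.append [j]
    · exact ⟨v, j, [], rfl, h⟩

variable (t : WLTree)

theorem nextCorner_of_lt {u : List ℕ} {j : ℕ} (h : j < t.numChildren u) :
    t.nextCorner (u, j) = (u ++ [j], 0) := by
  simp [nextCorner, h]

theorem nextCorner_append {u : List ℕ} {c j : ℕ} (h : t.numChildren (u ++ [c]) ≤ j) :
    t.nextCorner (u ++ [c], j) = (u, c + 1) := by
  simp [nextCorner, not_lt.2 h]

theorem corner_succ (n : ℕ) : t.corner (n + 1) = t.nextCorner (t.corner n) := rfl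

/-- All vertices that precede a corner have been visited before. -/
theorem exists_corner_of_precedes (n : ℕ) {z : List ℕ} (hz : z ∈ t.vertices)
    (h : Precedes z ((t.corner n).1 ++ [(t.corner n).2])) : ∃ n' ≤ n, (t.corner n').1 = z := by
  have hroot : ∀ n, Precedes z ([] ++ [0]) → ∃ n' ≤ n, (t.corner n').1 = z := by
    rintro n h
    rw [precedes_append_singleton] at h
    rcases h with ⟨w, d, s, hv, -⟩ | rfl | ⟨e, he, -⟩
    · simp at hv
    · exact ⟨0, by omega, rfl⟩
    · omega
  induction n with
  | zero => exact hroot 0 h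
  | succ n ih =>
    have ih' : Precedes z ((t.corner n).1 ++ [(t.corner n).2]) →
        ∃ n' ≤ n + 1, (t.corner n').1 = z := fun h => by
      obtain ⟨n', hn, h⟩ := ih h
      exact ⟨n', by omega, h⟩
    have hcur : (t.corner (n + 1)).1 = z → ∃ n' ≤ n + 1, (t.corner n').1 = z := fun h =>
      ⟨n + 1, le_rfl, h⟩
    rw [corner_succ] at h hcur
    generalize t.corner n = p at *
    obtain ⟨v, j⟩ := p
    by_cases hj : j < t.numChildren v
    · rw [t.nextCorner_of_lt hj] at h hcur
      rw [precedes_append_singleton] at h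
      rcases h with h | h | ⟨e, he, -⟩
      · exact ih' h
      · exact hcur h.symm
      · omega
    · rcases List.eq_nil_or_concat v with rfl | ⟨p, c, rfl⟩
      -- After the last corner of the root the exploration restarts at the root corner, which only
      -- the root precedes.
      · refine hroot _ ?_
        simpa [nextCorner, hj] using h
      · rw [List.concat_eq_append] at *
        rw [t.nextCorner_append (not_lt.1 hj), precedes_append_singleton] at h
        rcases h with h | h | ⟨e, he, r, h⟩
        · exact ih' ((h.append [c]).append [j])
        · exact ih' ((precedes_append_singleton.2 (Or.inr (Or.inl h))).append [j])
        · rcases Nat.lt_succ_iff_lt_or_eq.1 he with he | rfl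
          · exact ih' ((precedes_append_singleton.2 (Or.inr (Or.inr ⟨e, he, r, h⟩))).append [j])
          -- Here `z` lies in the subtree that has just been left; the indices of all the children
          -- of its root are below `j`.
          · refine ih' (precedes_append_singleton.2 (Or.inr ?_))
            cases r with
            | nil => exact Or.inl h
            | cons c r =>
              refine Or.inr ⟨c, ?_, r, by simpa using h⟩
              refine lt_of_lt_of_le ((t.mem_vertices_append_iff _ c).1 ?_) (not_lt.1 hj)
              refine t.mem_of_prefix _ r ?_
              simpa [h] using hz

/-- The exploration started at the first corner of `u` reaches the last corner of `u`, while
staying among the descendants of `u`. -/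
def Explored (u : List ℕ) : Prop :=
  ∀ n, t.corner n = (u, 0) → ∃ N, t.corner (n + N) = (u, t.numChildren u) ∧
    ∀ i ≤ N, u <+: (t.corner (n + i)).1

/-- The subtrees of the children are explored one after the other, each excursion bringing the
exploration from the corner `(u, e)` to the corner `(u, e + 1)`. -/
theorem exists_corner_of_explored {u : List ℕ} {c n : ℕ} (hc : c ≤ t.numChildren u)
    (hn : t.corner n = (u, 0)) (h : ∀ e < c, t.Explored (u ++ [e])) :
    ∃ N, t.corner (n + N) = (u, c) ∧
      ∀ i ≤ N, (t.corner (n + i)).1 = u ∨ ∃ e < c, ∃ r, (t.corner (n + i)).1 = u ++ e :: r := by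
  induction c with
  | zero => exact ⟨0, hn, fun i hi => Or.inl (by simp [Nat.le_zero.1 hi, hn])⟩
  | succ c ih =>
    obtain ⟨N, hN, hi⟩ := ih (by omega) fun e he => h e (by omega)
    have h1 : t.corner (n + N + 1) = (u ++ [c], 0) := by
      rw [corner_succ, hN, t.nextCorner_of_lt (by omega)]
    obtain ⟨N', hN', hi'⟩ := h c (by omega) _ h1
    -- One step down to the child, `N'` steps among its descendants, one step back up.
    have h2 : t.corner (n + (N + 1 + N' + 1)) = (u, c + 1) := by
      rw [show n + (N + 1 + N' + 1) = n + N + 1 + N' + 1 by ring, corner_succ, hN',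
        t.nextCorner_append le_rfl]
    refine ⟨N + 1 + N' + 1, h2, fun i hiN => ?_⟩
    rcases le_or_gt i N with h3 | h3
    · rcases hi i h3 with h4 | ⟨e, he, h4⟩
      · exact Or.inl h4
      · exact Or.inr ⟨e, by omega, h4⟩
    · rcases Nat.lt_or_ge i (N + 1 + N' + 1) with h4 | h4
      · obtain ⟨r, hr⟩ := hi' (i - (N + 1)) (by omega)
        rw [show n + N + 1 + (i - (N + 1)) = n + i by omega] at hr
        exact Or.inr ⟨c, by omega, r, by simpa using hr.symm⟩
      · rw [le_antisymm hiN h4, h2]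
        exact Or.inl rfl

/-- Induction on the number of descendants: the subtree of a child is strictly smaller because it
misses `u`. -/
theorem explored_of_finite (u : List ℕ) (h : {w | u ++ w ∈ t.vertices}.Finite) :
    t.Explored u := by
  induction hN : {w | u ++ w ∈ t.vertices}.ncard using Nat.strong_induction_on generalizing u with
  | _ N ih =>
    intro n hn
    have hu : u ∈ t.vertices := by
      have := t.corner_mem n
      rwa [hn] at this
    obtain ⟨M, hM, hi⟩ := t.exists_corner_of_explored le_rfl hn fun e _ => by
      have himg : (fun w => e :: w) '' {w | u ++ [e] ++ w ∈ t.vertices}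
          ⊂ {w | u ++ w ∈ t.vertices} := by
        refine ⟨?_, fun hsub => ?_⟩
        · rintro _ ⟨w, hw, rfl⟩
          simpa using hw
        · obtain ⟨w, -, hw⟩ := hsub (show [] ∈ {w | u ++ w ∈ t.vertices} by simpa using hu)
          simp at hw
      have hfin : {w | u ++ [e] ++ w ∈ t.vertices}.Finite :=
        Set.Finite.of_finite_image (h.subset himg.subset) List.cons_injective.injOn
      refine ih _ ?_ _ hfin rfl
      rw [← hN, ← Set.ncard_image_of_injective _ (List.cons_injective (a := e))]
      exact Set.ncard_lt_ncard himg h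
    refine ⟨M, hM, fun i hiM => ?_⟩
    rcases hi i hiM with h | ⟨e, -, r, h⟩ <;> rw [h]
    exact List.prefix_append _ _

/-- If the subtrees to the left of the branch from the root to `v` are finite, the exploration
reaches `v`, and has only visited vertices preceding `v` before. -/
theorem exists_corner_eq (v : List ℕ) (hv : v ∈ t.vertices)
    (h : ∀ w d s, v = w ++ d :: s → ∀ e < d, {r | w ++ [e] ++ r ∈ t.vertices}.Finite) :
    ∃ n, t.corner n = (v, 0) ∧ ∀ i < n, Precedes (t.corner i).1 v := by
  induction v using List.reverseRecOn with
  | nil => exact ⟨0, rfl, fun i hi => by omega⟩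
  | append_singleton v d ih =>
    obtain ⟨n, hn, hi⟩ := ih (t.parent_mem v d hv) fun w d' s hw => h w d' (s ++ [d]) (by simp [hw])
    have hd := (t.mem_vertices_append_iff v d).1 hv
    obtain ⟨N, hN, hi'⟩ := t.exists_corner_of_explored hd.le hn fun e he =>
      t.explored_of_finite _ (h v d [] rfl e he)
    refine ⟨n + N + 1, by rw [corner_succ, hN, t.nextCorner_of_lt hd], fun i hin => ?_⟩
    rw [precedes_append_singleton]
    rcases Nat.lt_or_ge i n with h1 | h1
    · exact Or.inl (hi i h1)
    · have := hi' (i - n) (by omega)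
      rw [Nat.add_sub_cancel' h1] at this
      exact Or.inr this

/-! ### Characterization of `e_k` -/

variable (k : ℕ)

theorem e_eq {v : List ℕ} (hv : t.label v = some (-(k : ℤ)))
    (hfin : ∀ w d s, v = w ++ d :: s → ∀ e < d, {r | w ++ [e] ++ r ∈ t.vertices}.Finite)
    (hlab : ∀ z, Precedes z v → t.label z ≠ some (-(k : ℤ))) : t.e k = v := by
  obtain ⟨n, hn, hi⟩ := t.exists_corner_eq v (by simp [vertices, hv]) hfin
  have : sInf {n | t.label (t.corner n).1 = some (-(k : ℤ))} = n := by
    refine le_antisymm (Nat.sInf_le (by simp [hn, hv])) (le_csInf ⟨n, by simp [hn, hv]⟩ ?_)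
    intro i hi'
    by_contra hlt
    exact hlab _ (hi i (not_le.1 hlt)) hi'
  rw [e, this, hn]

/-- Some corner has label `-k`. -/
def Hits : Prop := ∃ n, t.label (t.corner n).1 = some (-(k : ℤ))

theorem e_eq_nil_of_not_hits (h : ¬ t.Hits k) : t.e k = [] := by
  have : {n | t.label (t.corner n).1 = some (-(k : ℤ))} = ∅ :=
    Set.eq_empty_of_forall_notMem fun n hn => h ⟨n, hn⟩
  rw [e, this, Nat.sInf_empty]
  rfl

variable {t k}

theorem Hits.label_e (h : t.Hits k) : t.label (t.e k) = some (-(k : ℤ)) :=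
  Nat.sInf_mem (s := {n | t.label (t.corner n).1 = some (-(k : ℤ))}) h

theorem label_ne_of_precedes_e {z : List ℕ} (hz : Precedes z (t.e k)) :
    t.label z ≠ some (-(k : ℤ)) := by
  intro hlab
  obtain ⟨n', hn', rfl⟩ := t.exists_corner_of_precedes _
    (show z ∈ t.vertices by simp [vertices, hlab]) (hz.append _)
  refine Nat.notMem_of_lt_sInf (lt_of_le_of_ne hn' ?_) hlab
  rintro rfl
  exact hz.ne rfl

/-- These vertices were all visited by the time `e_k` is found. Hence the trees on the left of the
branch are finite, even though the whole tree is not. -/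
theorem finite_precedes_e : {z | z ∈ t.vertices ∧ Precedes z (t.e k)}.Finite := by
  refine ((Set.finite_Iic (sInf {n | t.label (t.corner n).1 = some (-(k : ℤ))})).image
    fun n => (t.corner n).1).subset ?_
  rintro z ⟨hz, h⟩
  obtain ⟨n', hn', rfl⟩ := t.exists_corner_of_precedes _ hz (h.append _)
  exact ⟨n', hn', rfl⟩


/-! ### The branch to `e_k` as a constrained branch -/

theorem leftPart_congr (t : WLTree) {w w' : List ℕ} (h : w = w') (hw : w ∈ t.vertices)
    (hw' : w' ∈ t.vertices) {d d' : ℕ} (hd : d = d') :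
    t.leftPart w hw d = t.leftPart w' hw' d' := by
  subst h hd; rfl

theorem rightPart_congr (t : WLTree) {w w' : List ℕ} (h : w = w') (hw : w ∈ t.vertices)
    (hw' : w' ∈ t.vertices) {d d' : ℕ} (hd : d = d') :
    t.rightPart w hw d = t.rightPart w' hw' d' := by
  subst h hd; rfl

theorem descendants_congr (t : WLTree) {w w' : List ℕ} (h : w = w') (hw : w ∈ t.vertices)
    (hw' : w' ∈ t.vertices) : t.descendants w hw = t.descendants w' hw' := by
  subst h; rfl

theorem leftPart_descendants (t : WLTree) (j : ℕ) (hj : [j] ∈ t.vertices) (w : List ℕ)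
    (hw : w ∈ (t.descendants [j] hj).vertices) (d : ℕ) :
    (t.descendants [j] hj).leftPart w hw d = t.leftPart (j :: w) hw d := by
  ext1
  funext u
  cases u <;> rfl

theorem rightPart_descendants (t : WLTree) (j : ℕ) (hj : [j] ∈ t.vertices) (w : List ℕ)
    (hw : w ∈ (t.descendants [j] hj).vertices) (d : ℕ) :
    (t.descendants [j] hj).rightPart w hw d = t.rightPart (j :: w) hw d := by
  ext1
  funext u
  cases u <;> rfl

end WLTree

/-- Passes from the recursion starting at the root to positions along the branch, where the `i`-th
ancestor of `v` is `v.take (m - i)`; this is the form in which `tau` and `tau'` are defined. -/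
theorem isBranch_iff (A B : ℕ → Set WLTree) (m : ℕ) (t : WLTree) (v : List ℕ) :
    IsBranch A B m t v ↔ ∃ hv : v ∈ t.vertices, v.length = m ∧
      (∀ i, 1 ≤ i → i ≤ m →
        t.leftPart (v.take (m - i)) (t.take_mem v _ hv) (v.getD (m - i) 0) ∈ A i ∧
        t.rightPart (v.take (m - i)) (t.take_mem v _ hv) (v.getD (m - i) 0) ∈ B i) ∧
      t.descendants v hv ∈ B 0 := by
  induction m generalizing t v with
  | zero =>
    cases v with
    | nil =>
      constructor
      · intro h
        exact ⟨t.root_mem, rfl, fun i h1 h2 => by omega, h⟩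
      · rintro ⟨_, -, -, h⟩
        exact h
    | cons j v => simp [IsBranch]
  | succ m ih =>
    cases v with
    | nil => simp [IsBranch]
    | cons j v =>
      have hbody : ∀ (hj : [j] ∈ t.vertices) (hv : j :: v ∈ t.vertices)
          (hv' : v ∈ (t.descendants [j] hj).vertices) (i : ℕ), i ≤ m →
          (t.descendants [j] hj).leftPart (v.take (m - i))
            ((t.descendants [j] hj).take_mem v _ hv') (v.getD (m - i) 0)
          = t.leftPart ((j :: v).take (m + 1 - i)) (t.take_mem _ _ hv)
            ((j :: v).getD (m + 1 - i) 0) ∧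
          (t.descendants [j] hj).rightPart (v.take (m - i))
            ((t.descendants [j] hj).take_mem v _ hv') (v.getD (m - i) 0)
          = t.rightPart ((j :: v).take (m + 1 - i)) (t.take_mem _ _ hv)
            ((j :: v).getD (m + 1 - i) 0) := by
        intro hj hv hv' i hi
        rw [leftPart_descendants, rightPart_descendants]
        exact ⟨t.leftPart_congr (by simp [Nat.succ_sub hi]) _ _ (by simp [Nat.succ_sub hi]),
          t.rightPart_congr (by simp [Nat.succ_sub hi]) _ _ (by simp [Nat.succ_sub hi])⟩
      have htop : ∀ (hv : j :: v ∈ t.vertices),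
          t.leftPart ((j :: v).take (m + 1 - (m + 1))) (t.take_mem _ _ hv)
            ((j :: v).getD (m + 1 - (m + 1)) 0) = t.leftR j ∧
          t.rightPart ((j :: v).take (m + 1 - (m + 1))) (t.take_mem _ _ hv)
            ((j :: v).getD (m + 1 - (m + 1)) 0) = t.rightR j := fun hv =>
        ⟨t.leftPart_congr (by simp) _ _ (by simp), t.rightPart_congr (by simp) _ _ (by simp)⟩
      simp only [IsBranch, ih]
      constructor
      · rintro ⟨hj, hl, hr, hv', hlen, hi, h0⟩
        have hj' : [j] ∈ t.vertices := t.mem_of_lt_numChildren [] j hj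
        rw! [t.childR_eq j hj'] at hv' hi h0
        have hv : j :: v ∈ t.vertices := hv'
        refine ⟨hv, by simp [hlen], fun i h1 h2 => ?_, h0⟩
        rcases Nat.lt_or_ge m i with h3 | h3
        · obtain rfl : i = m + 1 := by omega
          rw [(htop hv).1, (htop hv).2]
          exact ⟨hl, hr⟩
        · rw [← (hbody hj' hv hv' i h3).1, ← (hbody hj' hv hv' i h3).2]
          exact hi i h1 h3
      · rintro ⟨hv, hlen, hi, h0⟩
        have hj' : [j] ∈ t.vertices := t.mem_of_prefix [j] v hv
        have htop' := hi (m + 1) (by omega) le_rfl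
        rw [(htop hv).1, (htop hv).2] at htop'
        refine ⟨(t.mem_vertices_append_iff [] j).1 hj', htop'.1, htop'.2, ?_⟩
        rw [t.childR_eq j hj']
        refine ⟨hv, by simpa using hlen, fun i h1 h2 => ?_, h0⟩
        rw [(hbody hj' hv hv i h2).1, (hbody hj' hv hv i h2).2]
        exact hi i h1 (by omega)

theorem isBranch_e_iff (A B : ℕ → Set WLTree) (m k : ℕ) (t : WLTree) :
    IsBranch A B m (t.shift k) (t.e k) ↔ t.branchLength k = m ∧
      (∀ i, 1 ≤ i → i ≤ m → t.tau k i ∈ A i ∧ t.tau' k i ∈ B i) ∧ t.tau' k 0 ∈ B 0 := by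
  rw [isBranch_iff]
  constructor
  · rintro ⟨hv, rfl, hi, h0⟩
    refine ⟨rfl, fun i h1 h2 => ?_, ?_⟩
    · obtain ⟨i, rfl⟩ : ∃ i', i = i' + 1 := ⟨i - 1, by omega⟩
      exact hi _ h1 h2
    · have : t.tau' k 0 = (t.shift k).descendants (t.e k) hv :=
        descendants_congr _ (by simp [branchVertex, branchLength])
          (t.branchVertex_mem_shift k 0 k) _
      rwa [this]
  · rintro ⟨rfl, hi, h0⟩
    have hv := t.mem_shift k _ (t.e_mem k)
    refine ⟨hv, rfl, fun i h1 h2 => ?_, ?_⟩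
    · obtain ⟨i, rfl⟩ : ∃ i', i = i' + 1 := ⟨i - 1, by omega⟩
      exact hi _ h1 h2
    · have : t.tau' k 0 = (t.shift k).descendants (t.e k) hv :=
        descendants_congr _ (by simp [branchVertex, branchLength])
          (t.branchVertex_mem_shift k 0 k) _
      rwa [← this]

/-- The set of finite trees. -/
def finiteTrees : Set WLTree := {t | t.vertices.Finite}

/-! ### Deterministic properties of the labels and of the left trees along the branch to `e_k` -/

namespace WLTree

theorem tau_label_nil (t : WLTree) (k i : ℕ) : (t.tau k i).label [] = some (t.X k i) :=
  (Option.some_get _).symm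

theorem tau'_label_nil (t : WLTree) (k i : ℕ) : (t.tau' k i).label [] = some (t.X k i) := by
  cases i with
  | zero =>
    refine Eq.trans ?_ (Option.some_get _).symm
    change (t.shift k).label (_ ++ []) = _
    rw [List.append_nil]
  | succ i => exact (Option.some_get _).symm

theorem shift_label_eq_zero_iff (t : WLTree) (k : ℕ) (u : List ℕ) :
    (t.shift k).label u = some 0 ↔ t.label u = some (-(k : ℤ)) := by
  simp only [shift, Option.map_eq_some_iff]
  constructor
  · rintro ⟨a, ha, h⟩
    rw [ha, show a = -(k : ℤ) by omega]
  · exact fun h => ⟨_, h, by omega⟩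

/-- Labels move by at most one along an edge, so they cannot leave the positive integers without
taking the value `0`. -/
theorem mem_positiveTrees_of_ne_zero (t : WLTree) {x : ℤ} (hx : 0 < x) (h0 : t.label [] = some x)
    (h : ∀ u, t.label u ≠ some 0) : t ∈ positiveTrees := by
  intro u
  induction u using List.reverseRecOn with
  | nil => intro a ha; rw [h0] at ha; cases ha; exact hx
  | append_singleton u c ih =>
    intro a ha
    obtain ⟨b, hb⟩ := Option.isSome_iff_exists.1 (t.parent_mem u c (by simp [ha]))
    have h1 := ih b hb
    have h2 := abs_le.1 (t.label_step u c b a hb ha)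
    have h3 : a ≠ 0 := fun h' => h _ (h' ▸ ha)
    omega

theorem mem_leftPart_precedes (t : WLTree) {v : List ℕ} (w : List ℕ) (d : ℕ) (s : List ℕ)
    (hv : v = w ++ d :: s) (hw : w ∈ t.vertices) (u : List ℕ)
    (hu : u ∈ (t.leftPart w hw d).vertices) :
    (t.leftPart w hw d).label u = t.label (w ++ u) ∧ Precedes (w ++ u) v := by
  cases u with
  | nil => exact ⟨by simp [leftPart], w, d, s, hv, Or.inl (by simp)⟩
  | cons e r =>
    simp only [vertices, leftPart, Set.mem_ofPred_eq] at hu ⊢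
    by_cases he : e < d
    · exact ⟨if_pos he, w, d, s, hv, Or.inr ⟨e, he, r, rfl⟩⟩
    · simp [he] at hu

theorem branch_decomp (t : WLTree) (k i : ℕ) (h1 : 1 ≤ i) (h2 : i ≤ t.branchLength k) :
    ∃ s, t.e k = t.branchVertex k i ++ t.branchIndex k i :: s := by
  have h := t.branchVertex_pred k i h1 h2
  refine ⟨(t.e k).drop (t.branchLength k - (i - 1)), ?_⟩
  rw [List.append_cons, ← h]
  exact (List.take_append_drop _ _).symm

theorem Hits.X_zero {t : WLTree} {k : ℕ} (h : t.Hits k) : t.X k 0 = 0 := by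
  have h1 : (t.shift k).label (t.branchVertex k 0) = some 0 := by
    rw [shift_label_eq_zero_iff]
    simpa [branchVertex, branchLength] using h.label_e
  exact Option.get_of_mem _ h1

theorem X_label (t : WLTree) (k i : ℕ) :
    (t.shift k).label (t.branchVertex k i) = some (t.X k i) := (Option.some_get _).symm

theorem X_step (t : WLTree) (k i : ℕ) (h1 : 1 ≤ i) (h2 : i ≤ t.branchLength k) :
    |t.X k (i - 1) - t.X k i| ≤ 1 := by
  have h := t.X_label k (i - 1)
  rw [t.branchVertex_pred k i h1 h2] at h
  exact (t.shift k).label_step _ _ _ _ (t.X_label k i) h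

/-- Strict ancestors of `e_k` precede it, hence do not have label `-k`. -/
theorem X_ne_zero (t : WLTree) (k i : ℕ) (h1 : 1 ≤ i)
    (h2 : i ≤ t.branchLength k) : t.X k i ≠ 0 := by
  intro h0
  obtain ⟨s, hs⟩ := t.branch_decomp k i h1 h2
  refine label_ne_of_precedes_e (t := t) (k := k) (z := t.branchVertex k i) ⟨_, _, s, hs, Or.inl rfl⟩ ?_
  rw [← shift_label_eq_zero_iff, X_label, h0]

theorem X_last (t : WLTree) (k : ℕ) (h : t.label [] = some 0) : t.X k (t.branchLength k) = k := by
  have h1 := t.X_label k (t.branchLength k)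
  simpa [branchVertex, shift, h] using h1.symm

/-- Followed from the root, where it equals `k ≥ 1`, the label moves by steps of size at most one
and avoids `0` before reaching `e_k`. -/
theorem X_pos {t : WLTree} {k : ℕ} (hk : 1 ≤ k) (h0 : t.label [] = some 0) (i : ℕ)
    (h1 : 1 ≤ i) (h2 : i ≤ t.branchLength k) : 0 < t.X k i := by
  have key : ∀ j, j < t.branchLength k → 0 < t.X k (t.branchLength k - j) := by
    intro j hj
    induction j with
    | zero => rw [Nat.sub_zero, X_last t k h0]; exact_mod_cast hk
    | succ j ih =>
      have h3 := ih (by omega)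
      have h4 := abs_le.1 (t.X_step k (t.branchLength k - j) (by omega) (by omega))
      rw [Nat.sub_sub] at h4
      have h5 := t.X_ne_zero k (t.branchLength k - (j + 1)) (by omega) (by omega)
      omega
  have := key (t.branchLength k - i) (by omega)
  rwa [Nat.sub_sub_self h2] at this

theorem branchLength_pos {t : WLTree} {k : ℕ} (hk : 1 ≤ k) (h0 : t.label [] = some 0)
    (h : t.Hits k) : 1 ≤ t.branchLength k := by
  by_contra hlt
  have h1 : t.e k = [] := List.eq_nil_of_length_eq_zero (by unfold branchLength at hlt; omega)
  have h2 := h.label_e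
  rw [h1, h0, Option.some.injEq] at h2
  omega

theorem isPosWalk_X {t : WLTree} {k : ℕ} (hk : 1 ≤ k) (h0 : t.label [] = some 0)
    (h : t.Hits k) : IsPosWalk (t.branchLength k) 1 k (t.X k) where
  one_le := branchLength_pos hk h0 h
  first := by
    have h1 := branchLength_pos hk h0 h
    have h2 := X_pos hk h0 1 le_rfl h1
    have h3 := abs_le.1 (t.X_step k 1 le_rfl h1)
    rw [Nat.sub_self, h.X_zero] at h3
    omega
  last := t.X_last k h0
  pos := X_pos hk h0
  step_le i h1 h2 := by
    rw [abs_sub_comm]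
    exact t.X_step k (i + 1) (by omega) (by omega)

theorem tau_mem {t : WLTree} {k : ℕ} (hk : 1 ≤ k) (h0 : t.label [] = some 0)
    (i : ℕ) (h1 : 1 ≤ i) (h2 : i ≤ t.branchLength k) :
    t.tau k i ∈ positiveTrees ∩ finiteTrees := by
  obtain ⟨s, hs⟩ := t.branch_decomp k i h1 h2
  have hmem := (t.shift k).mem_leftPart_precedes _ _ s hs (t.branchVertex_mem_shift k i k)
  constructor
  · refine mem_positiveTrees_of_ne_zero _ (X_pos hk h0 i h1 h2) (t.tau_label_nil k i)
      fun u hu => ?_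
    obtain ⟨h3, h4⟩ := hmem u (by simp only [vertices, Set.mem_ofPred_eq]; rw [← tau, hu]; rfl)
    refine label_ne_of_precedes_e h4 ?_
    rw [← shift_label_eq_zero_iff, ← h3]
    exact hu
  · refine Set.Finite.of_finite_image ((finite_precedes_e (t := t) (k := k)).subset ?_)
      (List.append_right_injective (t.branchVertex k i)).injOn
    rintro _ ⟨u, hu, rfl⟩
    obtain ⟨h3, h4⟩ := hmem u hu
    refine ⟨?_, h4⟩
    simp only [vertices, Set.mem_ofPred_eq, tau] at hu ⊢
    rw [h3] at hu
    simpa [shift] using hu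

end WLTree

/-- Finite left trees let the exploration reach `v`; positive left trees exclude an earlier vertex
of shifted label `0`, including the ancestors of `v`, which are the roots of these trees. -/
theorem IsBranch.eq_e {A B : ℕ → Set WLTree} (hB : B 0 ⊆ {t | t.label [] = some 0})
    (hA : ∀ i, A (i + 1) ⊆ positiveTrees ∩ finiteTrees) {m k : ℕ} {t : WLTree} {v : List ℕ}
    (h : IsBranch A B m (t.shift k) v) : t.e k = v := by
  have h0 := h.label hB
  obtain ⟨hv, rfl, hi, -⟩ := (isBranch_iff _ _ _ _ _).1 h
  have hleft : ∀ w d s, v = w ++ d :: s → ∃ hw : w ∈ (t.shift k).vertices,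
      (t.shift k).leftPart w hw d ∈ positiveTrees ∩ finiteTrees := by
    intro w d s hvw
    have hw : w ∈ (t.shift k).vertices := (t.shift k).mem_of_prefix w (d :: s) (hvw ▸ hv)
    refine ⟨hw, ?_⟩
    have h1 := (hi (s.length + 1) (by omega) (by simp [hvw])).1
    refine hA s.length ?_
    convert h1 using 1
    exact leftPart_congr _ (by simp [hvw]) _ _ (by simp [hvw])
  refine t.e_eq k ((shift_label_eq_zero_iff t k v).1 h0) ?_ ?_
  · intro w d s hvw e he
    obtain ⟨hw, -, hfin⟩ := hleft w d s hvw
    refine (hfin.preimage (f := fun r => e :: r) List.cons_injective.injOn).subset ?_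
    intro r hr
    simp only [Set.mem_preimage, vertices, Set.mem_ofPred_eq, leftPart, if_pos he] at hr ⊢
    simpa [shift] using hr
  · rintro z ⟨w, d, s, hvw, hz⟩ hlab
    obtain ⟨hw, hpos, -⟩ := hleft w d s hvw
    rw [← shift_label_eq_zero_iff] at hlab
    rcases hz with rfl | ⟨e, he, r, rfl⟩
    · exact lt_irrefl _ (hpos [] 0 hlab)
    · exact lt_irrefl _ (hpos (e :: r) 0 (by simp only [leftPart, if_pos he]; exact hlab))

/-- Replaces the statement about `e_k` by the existence of a vertex, to which branch sums apply.
Positivity and finiteness of the left trees can be imposed freely because `tau_mem` provides them.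
At index `0` the label condition bears on the tree of descendants, as there is no left tree there.
-/
theorem exists_isBranch_iff {A B : ℕ → Set WLTree} {x : ℕ → ℤ} {k m : ℕ} (hk : 1 ≤ k)
    (hx : IsPosWalk m 1 k x) {t : WLTree} (h0 : t.label [] = some 0) :
    (∃ v, IsBranch (fun i => A i ∩ {t | t.label [] = some (x i)} ∩ (positiveTrees ∩ finiteTrees))
        (fun i => if i = 0 then B 0 ∩ {t | t.label [] = some 0} else B i) m (t.shift k) v) ↔
      t ∈ branchEvent k m x ∧ (∀ i, 1 ≤ i → i ≤ m → t.tau k i ∈ A i ∧ t.tau' k i ∈ B i) ∧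
        t.tau' k 0 ∈ B 0 := by
  constructor
  · rintro ⟨v, hv⟩
    have he := hv.eq_e (by simp) fun i => Set.inter_subset_right
    rw [← he, isBranch_e_iff] at hv
    obtain ⟨hm, hi, h⟩ := hv
    refine ⟨⟨hm, fun i h1 h2 => ?_⟩, fun i h1 h2 => ?_, (by simpa using h : _ ∧ _).1⟩
    · have := (hi i h1 h2).1.1.2
      simpa [tau_label_nil] using this
    · exact ⟨(hi i h1 h2).1.1.1, by simpa [show i ≠ 0 by omega] using (hi i h1 h2).2⟩
  · rintro ⟨⟨hm, hX⟩, hi, h⟩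
    -- Without a corner of label `-k`, `e_k` would be the root and the branch would have length `0`,
    -- whereas `m ≥ 1`.
    have hH : t.Hits k := by
      by_contra hH
      have := t.e_eq_nil_of_not_hits k hH
      have h1 := hx.one_le
      simp [branchLength, this] at hm
      omega
    refine ⟨t.e k, (isBranch_e_iff _ _ _ _ _).2 ⟨hm, fun i h1 h2 => ⟨⟨⟨(hi i h1 h2).1, ?_⟩,
      tau_mem hk h0 i h1 (by omega)⟩, ?_⟩, ?_⟩⟩
    · simp [tau_label_nil, hX i h1 h2]
    · simpa [show i ≠ 0 by omega] using (hi i h1 h2).2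
    · simp [h, tau'_label_nil, hH.X_zero]

/-! ### Finiteness and positivity of Galton–Watson trees -/

theorem measurableSet_positiveTrees : MeasurableSet positiveTrees := by
  have : positiveTrees = ⋂ u : List ℕ, {t : WLTree | ∀ a, t.label u = some a → 0 < a} := by
    ext t
    simp [positiveTrees]
  rw [this]
  exact MeasurableSet.iInter fun u => measurable_label u
    (MeasurableSet.of_discrete (s := {o : Option ℤ | ∀ a, o = some a → 0 < a}))

theorem measurableSet_finiteTrees : MeasurableSet finiteTrees := by
  have : finiteTrees = ⋃ s : Finset (List ℕ), ⋂ u : List ℕ,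
      {t : WLTree | u ∈ t.vertices → u ∈ s} := by
    ext t
    simp only [finiteTrees, Set.mem_ofPred_eq, Set.mem_iUnion, Set.mem_iInter]
    constructor
    · intro h
      exact ⟨h.toFinset, fun u hu => by simpa using hu⟩
    · rintro ⟨s, hs⟩
      exact s.finite_toSet.subset hs
  rw [this]
  refine MeasurableSet.iUnion fun s => MeasurableSet.iInter fun u => ?_
  exact measurable_label u (MeasurableSet.of_discrete (s := {o : Option ℤ | o.isSome → u ∈ s}))

namespace WLTree

theorem mem_finiteTrees_iff (t : WLTree) :
    t ∈ finiteTrees ↔ ∀ c < t.numChildren [], t.childR c ∈ finiteTrees := by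
  constructor
  · intro h c hc
    refine (h.preimage (f := fun u => c :: u) List.cons_injective.injOn).subset fun u hu => ?_
    simpa [vertices, childR_label t c hc] using hu
  · intro h
    refine ((Set.finite_singleton []).union ((Set.finite_Iio (t.numChildren [])).biUnion
      (t := fun c => (fun u => c :: u) '' (t.childR c).vertices)
      fun c hc => (h c hc).image _)).subset ?_
    intro u hu
    cases u with
    | nil => exact Or.inl rfl
    | cons c u =>
      have hc : c < t.numChildren [] := (t.mem_vertices_append_iff [] c).1 (t.mem_of_prefix [c] u hu)
      refine Or.inr (Set.mem_biUnion hc ⟨u, ?_, rfl⟩)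
      simpa [vertices, childR_label t c hc] using hu

theorem mem_positiveTrees_iff (t : WLTree) {x : ℤ} (hx : 0 < x) (h0 : t.label [] = some x) :
    t ∈ positiveTrees ↔ ∀ c < t.numChildren [], t.childR c ∈ positiveTrees := by
  constructor
  · intro h c hc u a ha
    rw [childR_label t c hc] at ha
    exact h _ a ha
  · intro h u a ha
    cases u with
    | nil =>
      rw [h0] at ha
      cases ha
      exact hx
    | cons c u =>
      have hc : c < t.numChildren [] := (t.mem_vertices_append_iff [] c).1
        (t.mem_of_prefix [c] u (by simp [vertices, ha]))
      exact h c hc u a (by rwa [childR_label t c hc])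

end WLTree

/-- The generating function of the offspring law, `E[p^N] = 1 / (2 - p)`, at `p = μ E`. -/
theorem lintegral_offspringLaw_children {Ω : Type*} [MeasurableSpace Ω] (μ : Measure Ω)
    [IsProbabilityMeasure μ] {E : Set Ω} (hE : MeasurableSet E) :
    ∫⁻ n, Measure.infinitePi (fun _ : ℕ => μ) {q | ∀ c < n, q c ∈ E} ∂offspringLaw
      = (2 - μ E)⁻¹ := by
  have h : ∀ n, Measure.infinitePi (fun _ : ℕ => μ) {q | ∀ c < n, q c ∈ E} = μ E ^ n := by
    intro n
    have : {q : ℕ → Ω | ∀ c < n, q c ∈ E} = (Finset.range n : Set ℕ).pi fun _ => E := by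
      ext q
      simp
    rw [this, Measure.infinitePi_pi _ fun _ _ => hE]
    simp
  simp only [h, lintegral_offspringLaw]
  have h2 : ∀ n : ℕ, (2⁻¹ : ℝ≥0∞) ^ (n + 1) * μ E ^ n = 2⁻¹ * (2⁻¹ * μ E) ^ n := fun n => by
    rw [pow_succ, mul_pow]
    ring
  simp only [h2, ENNReal.tsum_mul_left, ENNReal.tsum_geometric]
  rw [← ENNReal.mul_inv (by simp) (by simp), ENNReal.mul_sub (by simp), mul_one, ← mul_assoc,
    ENNReal.mul_inv_cancel (by simp) (by simp), one_mul]

/-- The common source of the equations for the finiteness and positivity probabilities: given the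
offspring number, the subtrees of the children are independent, with root label averaged over the
three neighbours of `x`. -/
theorem GW_apply_of_children (x : ℤ) {S S' : Set WLTree} (hS : MeasurableSet S)
    (hS' : MeasurableSet S') (h : ∀ t : WLTree, t.label [] = some x →
      (t ∈ S ↔ ∀ c < t.numChildren [], t.childR c ∈ S')) :
    GW x S = (2 - 3⁻¹ * (GW (x - 1) S' + GW x S' + GW (x + 1) S'))⁻¹ := by
  have hm : Measurable fun ω : GWNoise => gwTree (x + step (ω []).2) ω :=
    measurable_gwTree.comp (((Measurable.of_discrete (f := fun s => x + step s)).comp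
      (measurable_snd.comp (measurable_pi_apply []))).prodMk measurable_id)
  have hmS : MeasurableSet {ω : GWNoise | gwTree (x + step (ω []).2) ω ∈ S'} := hm hS'
  have hC : gwNoiseLaw {ω | gwTree (x + step (ω []).2) ω ∈ S'}
      = 3⁻¹ * (GW (x - 1) S' + GW x S' + GW (x + 1) S') := by
    have h1 := lintegral_child_gwNoiseLaw x (measurable_one.indicator hS')
    rw [stepAvg_eq] at h1
    simp only [lintegral_indicator_one hS'] at h1
    rw [← h1, ← lintegral_indicator_one hmS]
    rfl
  rw [← hC, ← lintegral_offspringLaw_children gwNoiseLaw hmS, ← lintegral_indicator_one hS,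
    lintegral_GW x (measurable_one.indicator hS), lintegral_gwNoiseLaw_of_root
      (f := fun ω => S.indicator 1 (gwTree x ω))
      ((measurable_one.indicator hS).comp (measurable_gwTree_right x))
      fun n s q => by simp only [gwTree_gwCons_root x n s q]]
  refine lintegral_congr fun n => ?_
  have hn : Measurable fun q : ℕ → GWNoise => gwTree x (gwCons (n, 0) q) :=
    (measurable_gwTree_right x).comp (measurable_gwCons.comp measurable_prodMk_left)
  have hset : {q : ℕ → GWNoise | ∀ c < n, q c ∈ {ω | gwTree (x + step (ω []).2) ω ∈ S'}}
      = (fun q => gwTree x (gwCons (n, 0) q)) ⁻¹' S := by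
    ext q
    simp only [Set.mem_ofPred_eq, Set.mem_preimage]
    rw [h _ (gwTree_label_nil x _), numChildren_gwTree]
    exact forall₂_congr fun c hc => by rw [childR_gwTree x n 0 q c hc]
  have hset' := hn hS
  change ∫⁻ q, _ ∂_ = Measure.infinitePi (fun _ : ℕ => gwNoiseLaw)
    {q : ℕ → GWNoise | ∀ c < n, q c ∈ {ω | gwTree (x + step (ω []).2) ω ∈ S'}}
  rw [hset, ← lintegral_indicator_one hset']
  rfl

/-! ### Almost sure finiteness -/

theorem GW_finiteTrees_eq (x y : ℤ) : GW x finiteTrees = GW y finiteTrees := by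
  rw [GW, GW, Measure.map_apply (measurable_gwTree_right x) measurableSet_finiteTrees,
    Measure.map_apply (measurable_gwTree_right y) measurableSet_finiteTrees]
  congr 1
  ext ω
  have : gwTree y ω = (gwTree x ω).shift (y - x) := by
    rw [gwTree_shift]
    congr 1
    ring
  simp only [Set.mem_preimage, this, finiteTrees, Set.mem_ofPred_eq]
  simp [vertices, shift]

/-- The probability does not depend on the label, so it solves `p (2 - p) = 1`, that is, `(p - 1)^2
= 0`: the tree is critical. -/
theorem GW_finiteTrees (x : ℤ) : GW x finiteTrees = 1 := by
  have h := GW_apply_of_children x measurableSet_finiteTrees measurableSet_finiteTrees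
    fun t _ => t.mem_finiteTrees_iff
  rw [GW_finiteTrees_eq (x - 1) x, GW_finiteTrees_eq (x + 1) x] at h
  have hle : GW x finiteTrees ≤ 1 := prob_le_one
  have hne : GW x finiteTrees ≠ ∞ := measure_ne_top _ _
  generalize GW x finiteTrees = p at *
  have h3 : 3⁻¹ * (p + p + p) = p := by
    rw [show p + p + p = 3 * p by ring, ← mul_assoc, ENNReal.inv_mul_cancel (by simp) (by simp),
      one_mul]
  rw [h3] at h
  have h4 := congrArg ENNReal.toReal h
  rw [ENNReal.toReal_inv, ENNReal.toReal_sub_of_le (hle.trans (by norm_num)) (by simp)] at h4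
  have h5 : p.toReal ≤ 1 := by
    simpa using ENNReal.toReal_mono (by simp) hle
  rw [ENNReal.toReal_ofNat] at h4
  have h6 : p.toReal * (2 - p.toReal) = 1 :=
    (mul_eq_one_iff_eq_inv₀ (by linarith)).2 h4
  have h7 : p.toReal = 1 := by nlinarith
  rw [← ENNReal.ofReal_toReal hne, h7, ENNReal.ofReal_one]

/-! ### The probability that all labels are positive -/

theorem GW_positiveTrees_of_nonpos (x : ℤ) (hx : x ≤ 0) : GW x positiveTrees = 0 := by
  rw [GW, Measure.map_apply (measurable_gwTree_right x) measurableSet_positiveTrees]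
  convert measure_empty (μ := gwNoiseLaw)
  refine Set.eq_empty_of_forall_notMem fun ω hω => ?_
  have := hω [] x (gwTree_label_nil x ω)
  omega

/-- The recursion satisfied by the probability that all labels are positive. -/
structure PositiveRec (a : ℕ → ℝ) : Prop where
  zero : a 0 = 0
  pos : ∀ n, 0 < a (n + 1)
  le_one : ∀ n, a n ≤ 1
  eq : ∀ n, a (n + 1) * (2 - 3⁻¹ * (a n + a (n + 1) + a (n + 2))) = 1

theorem PositiveRec.succ_succ {a : ℕ → ℝ} (h : PositiveRec a) (n : ℕ) :
    a (n + 2) = 6 - 3 / a (n + 1) - a (n + 1) - a n := by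
  have h1 := h.eq n
  have h2 := h.pos n
  field_simp
  linarith

/-- If `a 1 > b 1`, put `d = a - b`. The recursion gives `d (n+2) = 3 (1/b - 1/a) - d (n+1) - d n`,
with `a` and `b` taken at `n + 1`, and `1/b - 1/a ≥ d (n+1)`. So the increments of `d` do not
decrease and `d` grows at least linearly, which is impossible as both sequences stay in `[0, 1]`. -/
theorem PositiveRec.one_le {a b : ℕ → ℝ} (ha : PositiveRec a) (hb : PositiveRec b) :
    a 1 ≤ b 1 := by
  by_contra! hlt
  have key : ∀ n : ℕ, a 1 - b 1 ≤ (a (n + 1) - b (n + 1)) - (a n - b n) ∧ 0 ≤ a n - b n := by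
    intro n
    induction n with
    | zero => simp [ha.zero, hb.zero]
    | succ n ih =>
      obtain ⟨h1, h2⟩ := ih
      have hd : 0 ≤ a (n + 1) - b (n + 1) := by linarith
      refine ⟨?_, hd⟩
      rw [ha.succ_succ, hb.succ_succ]
      have ha0 := ha.pos n
      have hb0 := hb.pos n
      have h3 : a (n + 1) * b (n + 1) ≤ 1 := mul_le_one₀ (ha.le_one _) hb0.le (hb.le_one _)
      -- The right-hand side is `(a - b) / (a b)`, and `a b ≤ 1`.
      have h4 : a (n + 1) - b (n + 1) ≤ 1 / b (n + 1) - 1 / a (n + 1) := by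
        rw [div_sub_div _ _ hb0.ne' ha0.ne', le_div_iff₀ (by positivity)]
        nlinarith
      have h5 : 3 / b (n + 1) - 3 / a (n + 1) = 3 * (1 / b (n + 1) - 1 / a (n + 1)) := by ring
      linarith
  have hlin : ∀ n : ℕ, n * (a 1 - b 1) ≤ a n - b n := by
    intro n
    induction n with
    | zero => simp [ha.zero, hb.zero]
    | succ n ih =>
      have := (key n).1
      push_cast
      linarith
  obtain ⟨n, hn⟩ := exists_nat_gt (1 / (a 1 - b 1))
  rw [div_lt_iff₀ (by linarith)] at hn
  have h1 := hlin (n + 1)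
  have h2 := ha.le_one (n + 1)
  have h3 := hb.pos n
  push_cast at h1
  linarith

/-- The recursion has order two, the value at `0` is given, and `PositiveRec.one_le` used in both
directions fixes the value at `1`. -/
theorem PositiveRec.unique {a b : ℕ → ℝ} (ha : PositiveRec a) (hb : PositiveRec b) (n : ℕ) :
    a n = b n := by
  have key : ∀ n : ℕ, a n = b n ∧ a (n + 1) = b (n + 1) := by
    intro n
    induction n with
    | zero => exact ⟨by rw [ha.zero, hb.zero], le_antisymm (ha.one_le hb) (hb.one_le ha)⟩
    | succ n ih => exact ⟨ih.2, by rw [ha.succ_succ, hb.succ_succ, ih.1, ih.2]⟩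
  exact (key n).1

theorem w_pos {x : ℤ} (hx : 0 < x) : 0 < w x := by
  have : (0 : ℝ) < x := by exact_mod_cast hx
  unfold w
  positivity

theorem positiveRec_w : PositiveRec fun n => w n where
  zero := by simp [w]
  pos n := w_pos (by positivity)
  le_one n := by
    simp only [w, Int.cast_natCast]
    rw [div_le_one (by positivity)]
    nlinarith
  eq n := by
    simp only [w]
    push_cast
    have : (0 : ℝ) ≤ n := n.cast_nonneg
    field_simp
    ring

theorem positiveRec_GW : PositiveRec fun n => (GW n positiveTrees).toReal := by
  have hle : ∀ n : ℕ, (GW n positiveTrees).toReal ≤ 1 := fun n => by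
    simpa using ENNReal.toReal_mono ENNReal.one_ne_top (prob_le_one (μ := GW n) (s := positiveTrees))
  have heq : ∀ n : ℕ, (GW (n + 1 : ℕ) positiveTrees).toReal
      = (2 - 3⁻¹ * ((GW n positiveTrees).toReal + (GW (n + 1 : ℕ) positiveTrees).toReal
        + (GW (n + 2 : ℕ) positiveTrees).toReal))⁻¹ := by
    intro n
    have h := GW_apply_of_children (n + 1 : ℕ) measurableSet_positiveTrees
      measurableSet_positiveTrees fun t ht => t.mem_positiveTrees_iff (by positivity) ht
    rw [show ((n + 1 : ℕ) : ℤ) - 1 = n by push_cast; ring,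
      show ((n + 1 : ℕ) : ℤ) + 1 = (n + 2 : ℕ) by push_cast; ring] at h
    have hp : ∀ x : ℤ, GW x positiveTrees ≤ 1 := fun x => prob_le_one
    have hle2 : 3⁻¹ * (GW n positiveTrees + GW (n + 1 : ℕ) positiveTrees
        + GW (n + 2 : ℕ) positiveTrees) ≤ 2 := by
      calc _ ≤ 3⁻¹ * ((1 : ℝ≥0∞) + 1 + 1) := by gcongr <;> exact hp _
        _ = 1 := by
          rw [show (1 : ℝ≥0∞) + 1 + 1 = 3 by norm_num]
          exact ENNReal.inv_mul_cancel (by simp) (by simp)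
        _ ≤ 2 := by norm_num
    have h' := congrArg ENNReal.toReal h
    rw [ENNReal.toReal_inv, ENNReal.toReal_sub_of_le hle2 (by simp),
      ENNReal.toReal_mul, ENNReal.toReal_add (by simp) (by simp),
      ENNReal.toReal_add (by simp) (by simp), ENNReal.toReal_inv, ENNReal.toReal_ofNat,
      ENNReal.toReal_ofNat] at h'
    exact h'
  have hpos2 : ∀ n : ℕ, (0 : ℝ) < 2 - 3⁻¹ * ((GW n positiveTrees).toReal
      + (GW (n + 1 : ℕ) positiveTrees).toReal + (GW (n + 2 : ℕ) positiveTrees).toReal) := by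
    intro n
    have h1 := hle n
    have h2 := hle (n + 1)
    have h3 := hle (n + 2)
    linarith
  refine ⟨by simp [GW_positiveTrees_of_nonpos], fun n => ?_, hle, fun n => ?_⟩
  · rw [heq n]
    exact inv_pos.2 (hpos2 n)
  · conv_lhs => arg 1; rw [heq n]
    exact inv_mul_cancel₀ (hpos2 n).ne'

theorem GW_positiveTrees {x : ℤ} (hx : 0 < x) : GW x positiveTrees = ENNReal.ofReal (w x) := by
  lift x to ℕ using hx.le
  rw [← positiveRec_GW.unique positiveRec_w x, ENNReal.ofReal_toReal (measure_ne_top _ _)]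

/-! ### The vertex `e_k` exists almost surely -/

/-- All that hangs to the left of the spine belongs to the left trees, so when these are finite the
exploration reaches every spine vertex. The hypothesis covers all root labels since these change
along the induction. -/
theorem exists_spine_vertex (i : ℕ) (y : ℤ) (ω : SpineNoise)
    (h : ∀ j z, gwTree z (ω j).2.1 ∈ finiteTrees) :
    ∃ v, (uniformAt y ω).label v = some (y + spineWalk ω i) ∧ ∀ w d s, v = w ++ d :: s →
      ∀ e < d, {r | w ++ [e] ++ r ∈ (uniformAt y ω).vertices}.Finite := by
  induction i generalizing y ω with
  | zero => exact ⟨[], by simp [uniformAt_label_nil, spineWalk], by simp⟩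
  | succ i ih =>
    obtain ⟨v, hv, hfin⟩ := ih (y + step (ω 0).1) (fun i => ω (i + 1)) fun j => h (j + 1)
    have hω : seqCons ((ω 0).1, (ω 0).2.1, (ω 0).2.2) (fun i => ω (i + 1)) = ω := by
      funext i
      cases i <;> rfl
    have hlab := uniformAt_label_cons y (ω 0).1 (ω 0).2.1 (ω 0).2.2 fun i => ω (i + 1)
    have hwalk := spineWalk_seqCons_succ ((ω 0).1, (ω 0).2.1, (ω 0).2.2) (fun i => ω (i + 1)) i
    rw [hω] at hlab hwalk
    refine ⟨((ω 0).2.1 []).1 :: v, ?_, ?_⟩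
    · rw [hlab, if_neg (lt_irrefl _), if_pos rfl, hv, hwalk]
      congr 1
      ring
    · intro w d s hw e he
      cases w with
      | nil =>
        obtain ⟨rfl, rfl⟩ : ((ω 0).2.1 []).1 = d ∧ v = s := by simpa using hw
        refine ((h 0 y).preimage (f := fun r => e :: r) List.cons_injective.injOn).subset ?_
        intro r hr
        simpa [vertices, hlab, he] using hr
      | cons c w =>
        obtain ⟨rfl, rfl⟩ : ((ω 0).2.1 []).1 = c ∧ v = w ++ d :: s := by simpa using hw
        refine (hfin w d s rfl e he).subset fun r hr => ?_
        simpa [vertices, hlab] using hr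

theorem uniformAt_zero (ω : SpineNoise) : uniformAt 0 ω = uniformTree ω := by
  ext1
  funext u
  simp [uniformAt, shift]

theorem hits_uniformTree (k : ℕ) (ω : SpineNoise) (h : ∀ j z, gwTree z (ω j).2.1 ∈ finiteTrees)
    (hk : ∃ i, (k : ℤ) + spineWalk ω i = 0) : (uniformTree ω).Hits k := by
  obtain ⟨i, hi⟩ := hk
  obtain ⟨v, hv, hfin⟩ := exists_spine_vertex i 0 ω h
  rw [uniformAt_zero] at hv hfin
  obtain ⟨n, hn, -⟩ := (uniformTree ω).exists_corner_eq v (by simp [vertices, hv]) hfin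
  refine ⟨n, ?_⟩
  rw [hn, hv]
  congr 1
  omega

theorem ae_left_finite :
    ∀ᵐ ω ∂spineNoiseLaw, ∀ j z, gwTree z (ω j).2.1 ∈ finiteTrees := by
  rw [ae_all_iff]
  intro j
  rw [ae_all_iff]
  intro z
  have h1 : ∀ᵐ ω ∂gwNoiseLaw, gwTree z ω ∈ finiteTrees := by
    have h := GW_finiteTrees z
    rw [GW, Measure.map_apply (measurable_gwTree_right z) measurableSet_finiteTrees] at h
    exact (prob_compl_eq_zero_iff (measurable_gwTree_right z measurableSet_finiteTrees)).2 h
  have hq : Measure.QuasiMeasurePreserving (fun ω : SpineNoise => (ω j).2.1) spineNoiseLaw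
      gwNoiseLaw := by
    have h2 := (measurePreserving_eval_infinitePi
      (fun _ : ℕ => stepLaw.prod (gwNoiseLaw.prod gwNoiseLaw)) j).quasiMeasurePreserving
    exact (Measure.quasiMeasurePreserving_fst.comp Measure.quasiMeasurePreserving_snd).comp h2
  exact hq.ae h1

/-- The equation makes `q` affine; as `q 0 = 1`, the upper bound forbids a positive slope and the
lower bound a negative one. Applied to hitting probabilities, this gives the recurrence of the spine
walk. -/
theorem eq_one_of_harmonic {q : ℕ → ℝ} (h0 : q 0 = 1) (h1 : ∀ n, q n ≤ 1) (h2 : ∀ n, 0 ≤ q n)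
    (h : ∀ n, q (n + 1) = 3⁻¹ * (q n + q (n + 1) + q (n + 2))) (n : ℕ) : q n = 1 := by
  have key : ∀ n : ℕ, q n = 1 + n * (q 1 - 1) ∧ q (n + 1) = 1 + (n + 1) * (q 1 - 1) := by
    intro n
    induction n with
    | zero => simp [h0]
    | succ n ih =>
      refine ⟨by rw [ih.2]; push_cast; ring, ?_⟩
      have h3 := h n
      have h4 : q (n + 2) = 2 * q (n + 1) - q n := by linarith
      rw [show n + 1 + 1 = n + 2 by rfl, h4, ih.1, ih.2]
      push_cast
      ring
  have hd : q 1 = 1 := by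
    by_contra hne
    have hlt : 0 < 1 - q 1 := sub_pos.2 (lt_of_le_of_ne (h1 1) hne)
    obtain ⟨n, hn⟩ := exists_nat_gt (1 / (1 - q 1))
    rw [div_lt_iff₀ hlt] at hn
    have h3 := h2 n
    rw [(key n).1] at h3
    linarith
  rw [(key n).1, hd]
  ring

theorem measurableSet_hitsWalk (y : ℤ) :
    MeasurableSet {ω : SpineNoise | ∃ i, y + spineWalk ω i = 0} := by
  have : {ω : SpineNoise | ∃ i, y + spineWalk ω i = 0}
      = ⋃ i, (fun ω => spineWalk ω i) ⁻¹' {z | y + z = 0} := by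
    ext ω
    simp
  rw [this]
  exact MeasurableSet.iUnion fun i => measurable_spineWalk i MeasurableSet.of_discrete

/-- First-step analysis; `y ≠ 0` excludes a hit at time `0`. -/
theorem spineNoiseLaw_hits_eq (y : ℤ) (hy : y ≠ 0) :
    spineNoiseLaw {ω | ∃ i, y + spineWalk ω i = 0}
      = 3⁻¹ * (spineNoiseLaw {ω | ∃ i, y - 1 + spineWalk ω i = 0}
        + spineNoiseLaw {ω | ∃ i, y + spineWalk ω i = 0}
        + spineNoiseLaw {ω | ∃ i, y + 1 + spineWalk ω i = 0}) := by
  have hind : ∀ s ωL ωR ω, {ω : SpineNoise | ∃ i, y + spineWalk ω i = 0}.indicator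
      (1 : SpineNoise → ℝ≥0∞) (seqCons (s, ωL, ωR) ω)
      = {ω : SpineNoise | ∃ i, y + step s + spineWalk ω i = 0}.indicator 1 ω := by
    intro s ωL ωR ω
    refine Set.indicator_eq_indicator ?_ rfl
    simp only [Set.mem_ofPred_eq]
    constructor
    · rintro ⟨_ | i, hi⟩
      · exact absurd hi (by simpa [spineWalk] using hy)
      · rw [spineWalk_seqCons_succ] at hi
        exact ⟨i, by linarith⟩
    · rintro ⟨i, hi⟩
      exact ⟨i + 1, by rw [spineWalk_seqCons_succ]; linarith⟩
  conv_lhs => rw [← lintegral_indicator_one (measurableSet_hitsWalk y),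
    lintegral_spineNoiseLaw (measurable_one.indicator (measurableSet_hitsWalk y))]
  simp only [hind, lintegral_const, measure_univ, mul_one, lintegral_stepLaw,
    lintegral_indicator_one (measurableSet_hitsWalk _)]
  simp [step, sub_eq_add_neg]

theorem spineNoiseLaw_hits (n : ℕ) :
    spineNoiseLaw {ω | ∃ i, (n : ℤ) + spineWalk ω i = 0} = 1 := by
  have h := eq_one_of_harmonic
    (q := fun n : ℕ => (spineNoiseLaw {ω | ∃ i, (n : ℤ) + spineWalk ω i = 0}).toReal) ?_ ?_
    (fun _ => ENNReal.toReal_nonneg) ?_ n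
  · rw [← ENNReal.ofReal_toReal (measure_ne_top spineNoiseLaw
      {ω | ∃ i, (n : ℤ) + spineWalk ω i = 0}), h, ENNReal.ofReal_one]
  · have : {ω : SpineNoise | ∃ i, ((0 : ℕ) : ℤ) + spineWalk ω i = 0} = Set.univ :=
      Set.eq_univ_of_forall fun ω => ⟨0, by simp [spineWalk]⟩
    simp only [this, measure_univ, ENNReal.toReal_one]
  · intro n
    simpa using ENNReal.toReal_mono ENNReal.one_ne_top (prob_le_one (μ := spineNoiseLaw)
      (s := {ω | ∃ i, (n : ℤ) + spineWalk ω i = 0}))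
  · intro n
    have := congrArg ENNReal.toReal (spineNoiseLaw_hits_eq ((n + 1 : ℕ) : ℤ) (by positivity))
    rw [ENNReal.toReal_mul, ENNReal.toReal_add (by simp) (by simp),
      ENNReal.toReal_add (by simp) (by simp),
      show ((n + 1 : ℕ) : ℤ) - 1 = n by push_cast; ring,
      show ((n + 1 : ℕ) : ℤ) + 1 = (n + 2 : ℕ) by push_cast; ring] at this
    simpa using this

/-! ### Measurability of the branch and of the attached trees -/

theorem measurableSet_corner_eq (n : ℕ) (p : List ℕ × ℕ) :
    MeasurableSet {t : WLTree | t.corner n = p} := by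
  induction n generalizing p with
  | zero => exact MeasurableSet.const (([], 0) = p)
  | succ n ih =>
    have : {t : WLTree | t.corner (n + 1) = p}
        = ⋃ q, {t : WLTree | t.corner n = q} ∩ {t : WLTree | t.nextCorner q = p} := by
      ext t
      simp [corner_succ]
    rw [this]
    refine MeasurableSet.iUnion fun q => (ih q).inter ?_
    exact measurable_numChildren q.1 (MeasurableSet.of_discrete (s := {N : ℕ |
      (if q.2 < N then (q.1 ++ [q.2], 0)
        else match q.1.getLast? with
          | none => ([], 0)
          | some c => (q.1.dropLast, c + 1)) = p}))

theorem measurableSet_label_corner (n : ℕ) (a : ℤ) :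
    MeasurableSet {t : WLTree | t.label (t.corner n).1 = some a} := by
  have : {t : WLTree | t.label (t.corner n).1 = some a}
      = ⋃ p, {t : WLTree | t.corner n = p} ∩ {t : WLTree | t.label p.1 = some a} := by
    ext t
    simp only [Set.mem_ofPred_eq, Set.mem_iUnion, Set.mem_inter_iff]
    exact ⟨fun h => ⟨_, rfl, h⟩, fun ⟨p, hp, h⟩ => hp ▸ h⟩
  rw [this]
  exact MeasurableSet.iUnion fun p => (measurableSet_corner_eq n p).inter
    (measurable_label p.1 (MeasurableSet.of_discrete (s := {some a})))

theorem measurableSet_hits (k : ℕ) : MeasurableSet {t : WLTree | t.Hits k} := by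
  have : {t : WLTree | t.Hits k} = ⋃ n, {t : WLTree | t.label (t.corner n).1 = some (-(k : ℤ))} := by
    ext t
    simp [Hits]
  rw [this]
  exact MeasurableSet.iUnion fun n => measurableSet_label_corner n _

theorem measurableSet_e_eq (k : ℕ) (v : List ℕ) : MeasurableSet {t : WLTree | t.e k = v} := by
  have : {t : WLTree | t.e k = v}
      -- Decomposition according to the first time `n` at which the label `-k` is met, plus the case
      -- where it never is and `e_k` is the root by convention.
      = (⋃ n, ⋃ j, ({t : WLTree | t.label (t.corner n).1 = some (-(k : ℤ))} ∩
          ⋂ i, ⋂ _ : i < n, {t : WLTree | t.label (t.corner i).1 = some (-(k : ℤ))}ᶜ) ∩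
            {t : WLTree | t.corner n = (v, j)}) ∪
        {t : WLTree | t.Hits k}ᶜ ∩ {_t : WLTree | v = []} := by
    ext t
    have hfirst : ∀ n, t.label (t.corner n).1 = some (-(k : ℤ)) →
        (∀ i < n, t.label (t.corner i).1 ≠ some (-(k : ℤ))) → t.e k = (t.corner n).1 := by
      intro n h1 h2
      have : sInf {n | t.label (t.corner n).1 = some (-(k : ℤ))} = n := by
        refine le_antisymm (Nat.sInf_le h1) (le_csInf ⟨n, h1⟩ fun i hi => ?_)
        by_contra hlt
        exact h2 i (not_le.1 hlt) hi
      rw [e, this]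
    simp only [Set.mem_ofPred_eq, Set.mem_union, Set.mem_iUnion, Set.mem_inter_iff,
      Set.mem_iInter, Set.mem_compl_iff]
    constructor
    · intro h
      by_cases hH : t.Hits k
      · classical
        have hfind := hfirst (Nat.find hH) (Nat.find_spec hH) fun i hi => Nat.find_min hH hi
        exact Or.inl ⟨Nat.find hH, (t.corner (Nat.find hH)).2,
          ⟨Nat.find_spec hH, fun i hi => Nat.find_min hH hi⟩, by rw [← h, hfind]⟩
      · exact Or.inr ⟨hH, by rw [← h, t.e_eq_nil_of_not_hits k hH]⟩
    · rintro (⟨n, j, ⟨h1, h2⟩, h3⟩ | ⟨hH, rfl⟩)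
      · rw [hfirst n h1 h2, h3]
      · exact t.e_eq_nil_of_not_hits k hH
  rw [this]
  refine MeasurableSet.union (MeasurableSet.iUnion fun n => MeasurableSet.iUnion fun j => ?_)
    ((measurableSet_hits k).compl.inter (MeasurableSet.const _))
  exact ((measurableSet_label_corner n _).inter (MeasurableSet.iInter fun i =>
    MeasurableSet.iInter fun _ => (measurableSet_label_corner i _).compl)).inter
    (measurableSet_corner_eq n _)

/-- There are countably many words, and on each event `e_k = v` the map coincides with the
measurable map `G v`. -/
theorem measurable_of_e {β : Type*} [MeasurableSpace β] (k : ℕ) {F : WLTree → β}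
    (G : List ℕ → WLTree → β) (hG : ∀ v, Measurable (G v)) (hF : ∀ t, F t = G (t.e k) t) :
    Measurable F := by
  intro S hS
  have : F ⁻¹' S = ⋃ v, {t : WLTree | t.e k = v} ∩ G v ⁻¹' S := by
    ext t
    simp [hF]
  rw [this]
  exact MeasurableSet.iUnion fun v => (measurableSet_e_eq k v).inter (hG v hS)

theorem measurable_tau (k i : ℕ) : Measurable fun t : WLTree => t.tau k i := by
  refine measurable_wlTree fun u => ?_
  cases u with
  | nil =>
    exact measurable_of_e k (fun v t => (t.shift k).label (v.take (v.length - i)))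
      (fun v => (measurable_label _).comp (measurable_shift k)) fun t => rfl
  | cons c u =>
    refine measurable_of_e k (fun v t => if c < v.getD (v.length - i) 0 then
      (t.shift k).label (v.take (v.length - i) ++ c :: u) else none) (fun v => ?_) fun t => rfl
    by_cases h : c < v.getD (v.length - i) 0
    · simp only [if_pos h]
      exact (measurable_label _).comp (measurable_shift k)
    · simp only [if_neg h]
      exact measurable_const

theorem measurable_tau' (k i : ℕ) : Measurable fun t : WLTree => t.tau' k i := by
  refine measurable_wlTree fun u => ?_
  cases i with
  | zero =>
    exact measurable_of_e k (fun v t => (t.shift k).label (v.take (v.length - 0) ++ u))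
      (fun v => (measurable_label _).comp (measurable_shift k)) fun t => rfl
  | succ i =>
    cases u with
    | nil =>
      exact measurable_of_e k (fun v t => (t.shift k).label (v.take (v.length - (i + 1))))
        (fun v => (measurable_label _).comp (measurable_shift k)) fun t => rfl
    | cons c u =>
      exact measurable_of_e k (fun v t => (t.shift k).label (v.take (v.length - (i + 1)) ++
          (c + v.getD (v.length - (i + 1)) 0 + 1) :: u))
        (fun v => (measurable_label _).comp (measurable_shift k)) fun t => rfl

theorem measurableSet_branchEvent (k m : ℕ) (x : ℕ → ℤ) : MeasurableSet (branchEvent k m x) := by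
  have : branchEvent k m x = (⋃ v : List ℕ, {t : WLTree | t.e k = v} ∩ {_t : WLTree | v.length = m})
      ∩ ⋂ i, ⋂ _ : 1 ≤ i, ⋂ _ : i ≤ m, {t : WLTree | (t.tau k i).label [] = some (x i)} := by
    ext t
    simp [branchEvent, branchLength, tau_label_nil]
  rw [this]
  refine MeasurableSet.inter (MeasurableSet.iUnion fun v =>
    (measurableSet_e_eq k v).inter (MeasurableSet.const _)) ?_
  exact MeasurableSet.iInter fun i => MeasurableSet.iInter fun _ => MeasurableSet.iInter fun _ =>
    ((measurable_label []).comp (measurable_tau k i))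
      (MeasurableSet.of_discrete (s := {some (x i)}))

/-! ### The law of the branch and of the attached trees -/

theorem uniformTree_label_nil (ω : SpineNoise) : (uniformTree ω).label [] = some 0 := by
  rw [← uniformAt_zero, uniformAt_label_nil]

theorem measurableSet_root (x : ℤ) : MeasurableSet {t : WLTree | t.label [] = some x} :=
  measurable_label [] (MeasurableSet.of_discrete (s := {some x}))

theorem ae_uniformLaw_iff {P : WLTree → Prop} (hP : MeasurableSet {t | P t}) :
    (∀ᵐ t ∂uniformLaw, P t) ↔ ∀ᵐ ω ∂spineNoiseLaw, P (uniformTree ω) :=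
  ae_map_iff measurable_uniformTree.aemeasurable hP

theorem ae_uniformLaw_label_nil : ∀ᵐ t ∂uniformLaw, t.label [] = some 0 :=
  (ae_uniformLaw_iff (measurableSet_root 0)).2 (Filter.Eventually.of_forall uniformTree_label_nil)

theorem ae_hits (k : ℕ) : ∀ᵐ t ∂uniformLaw, t.Hits k := by
  rw [ae_uniformLaw_iff (measurableSet_hits k)]
  have h : ∀ᵐ ω ∂spineNoiseLaw, ∃ i, (k : ℤ) + spineWalk ω i = 0 :=
    (prob_compl_eq_zero_iff (measurableSet_hitsWalk k)).2 (spineNoiseLaw_hits k)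
  filter_upwards [h, ae_left_finite] with ω h1 h2 using hits_uniformTree k ω h2 h1

theorem ae_uniformLawAt_label_nil (y : ℤ) : ∀ᵐ t ∂uniformLawAt y, t.label [] = some y := by
  rw [uniformLawAt, ae_map_iff (measurable_shift y).aemeasurable (measurableSet_root y)]
  filter_upwards [ae_uniformLaw_label_nil] with t ht
  simp [shift, ht]

theorem ae_GW_label_nil (y : ℤ) : ∀ᵐ t ∂GW y, t.label [] = some y := by
  rw [GW, ae_map_iff (measurable_gwTree_right y).aemeasurable (measurableSet_root y)]
  exact Filter.Eventually.of_forall (gwTree_label_nil y)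

theorem ae_GW_finiteTrees (y : ℤ) : ∀ᵐ t ∂GW y, t ∈ finiteTrees :=
  (prob_compl_eq_zero_iff measurableSet_finiteTrees).2 (GW_finiteTrees y)

theorem GW_positiveTrees_ne_zero {x : ℤ} (hx : 0 < x) : GW x positiveTrees ≠ 0 := by
  rw [GW_positiveTrees hx]
  simpa using w_pos hx

theorem isProbabilityMeasure_GWplus {x : ℤ} (hx : 0 < x) : IsProbabilityMeasure (GWplus x) :=
  cond_isProbabilityMeasure (GW_positiveTrees_ne_zero hx)

/-- The weights `w(x_i)` enter here, as the normalising constants of the conditioning; the root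
label and finiteness conditions hold almost surely. -/
theorem GW_inter_eq {x : ℤ} (hx : 0 < x) (A : Set WLTree) :
    GW x (A ∩ {t | t.label [] = some x} ∩ (positiveTrees ∩ finiteTrees))
      = ENNReal.ofReal (w x) * GWplus x A := by
  have h1 : GW x (A ∩ {t | t.label [] = some x} ∩ (positiveTrees ∩ finiteTrees))
      = GW x (positiveTrees ∩ A) := by
    refine measure_congr ?_
    filter_upwards [ae_GW_label_nil x, ae_GW_finiteTrees x] with t h1 h2
    refine propext ?_
    change ((t ∈ A ∧ t.label [] = some x) ∧ t ∈ positiveTrees ∧ t ∈ finiteTrees) ↔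
      t ∈ positiveTrees ∧ t ∈ A
    tauto
  rw [h1, ← GW_positiveTrees hx, GWplus, mul_comm]
  exact (cond_mul_eq_inter measurableSet_positiveTrees A (GW x)).symm

theorem measure_inter_root {μ : Measure WLTree} {x : ℤ} (h : ∀ᵐ t ∂μ, t.label [] = some x)
    (A : Set WLTree) : μ (A ∩ {t | t.label [] = some x}) = μ A := by
  refine measure_congr ?_
  filter_upwards [h] with t ht
  exact propext (and_iff_left ht)

/-- The law of the branch and the trees attached to it, on boxes. -/
theorem uniformLaw_branch_box {k m : ℕ} (hk : 1 ≤ k) {x : ℕ → ℤ} (hx : IsPosWalk m 1 k x)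
    {A B : ℕ → Set WLTree} (hA : ∀ i, MeasurableSet (A i)) (hB : ∀ i, MeasurableSet (B i)) :
    uniformLaw {t | t ∈ branchEvent k m x ∧
        (∀ i, 1 ≤ i → i ≤ m → t.tau k i ∈ A i ∧ t.tau' k i ∈ B i) ∧ t.tau' k 0 ∈ B 0}
      = 3⁻¹ ^ m * (∏ i ∈ Finset.range m, ENNReal.ofReal (w (x (i + 1))) * GWplus (x (i + 1)) (A (i + 1)))
        * ∑ I ∈ Finset.range (m + 1), ∏ i ∈ Finset.range (m + 1),
          (if i = I then uniformLawAt (if i = 0 then 0 else x i)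
            else GW (if i = 0 then 0 else x i)) (B i) := by
  -- The tip `e_k` has shifted label `0`, whereas the value `x 0` is arbitrary.
  set x' : ℕ → ℤ := fun i => if i = 0 then 0 else x i with hx'
  set A' : ℕ → Set WLTree :=
    fun i => A i ∩ {t | t.label [] = some (x i)} ∩ (positiveTrees ∩ finiteTrees) with hA'
  set B' : ℕ → Set WLTree :=
    fun i => if i = 0 then B 0 ∩ {t | t.label [] = some 0} else B i with hB'
  have hAm : ∀ i, MeasurableSet (A' i) := fun i => ((hA i).inter (measurableSet_root _)).inter
    (measurableSet_positiveTrees.inter measurableSet_finiteTrees)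
  have hBm : ∀ i, MeasurableSet (B' i) := fun i => by
    by_cases h : i = 0
    · simpa [hB', h] using (hB 0).inter (measurableSet_root 0)
    · simpa [hB', h] using hB i
  have hsum := branchSum_indicator (A := A') (B := B') (by simp [hB'])
    (fun i => Set.inter_subset_right.trans Set.inter_subset_left) m
  have hfm : ∀ i, Measurable ((A' i).indicator (1 : WLTree → ℝ≥0∞)) := fun i =>
    measurable_one.indicator (hAm i)
  have hgm : ∀ i, Measurable ((B' i).indicator (1 : WLTree → ℝ≥0∞)) := fun i =>
    measurable_one.indicator (hBm i)
  have hmeas := measurable_branchSum hfm hgm m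
  have hbr : MeasurableSet {t | ∃ v, IsBranch A' B' m t v} := by
    have : {t | ∃ v, IsBranch A' B' m t v} = branchSum (fun i => (A' i).indicator 1)
        (fun i => (B' i).indicator 1) m ⁻¹' {1} := by
      ext t
      rw [Set.mem_preimage, hsum]
      by_cases h : t ∈ {t | ∃ v, IsBranch A' B' m t v} <;> simp [h]
    rw [this]
    exact hmeas (measurableSet_singleton 1)
  have hm1 := hx.one_le
  have hxm : x' m = k := by simp [hx', show m ≠ 0 by omega, hx.last]
  -- After the shift by `k` the root has label `k = x' m`, the starting label required by the branch
  -- sum.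
  have hcongr : uniformLaw {t | t ∈ branchEvent k m x ∧
        (∀ i, 1 ≤ i → i ≤ m → t.tau k i ∈ A i ∧ t.tau' k i ∈ B i) ∧ t.tau' k 0 ∈ B 0}
      = uniformLawAt (x' m) {t | ∃ v, IsBranch A' B' m t v} := by
    rw [hxm, uniformLawAt, Measure.map_apply (measurable_shift k) hbr]
    refine measure_congr ?_
    filter_upwards [ae_uniformLaw_label_nil] with t ht
    exact propext (exists_isBranch_iff hk hx ht).symm
  have hstep : ∀ i < m, |x' (i + 1) - x' i| ≤ 1 := by
    intro i hi
    rcases Nat.eq_zero_or_pos i with rfl | h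
    · simp [hx', hx.first]
    · simpa [hx', show i ≠ 0 by omega] using hx.step_le i h hi
  have hmain := lintegral_branchSum_uniformLawAt (x := x') hfm hgm
    (fun i t ht => Set.indicator_of_notMem (fun h => ht (by simpa [hx'] using h.1.2)) _)
    (fun i t ht => Set.indicator_of_notMem (fun h => ht h.2.2) _)
    (fun t ht => Set.indicator_of_notMem
      (fun h => ht (by simpa [hx'] using (by simpa [hB'] using h : _ ∧ _).2)) _) m hstep
  simp only [hsum, lintegral_indicator_one hbr, lintegral_indicator_one (hAm _),
    lintegral_indicator_one (hBm _)] at hmain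
  rw [hcongr, hmain]
  congr 1
  · congr 1
    refine Finset.prod_congr rfl fun i hi => ?_
    have hi := Finset.mem_range.1 hi
    have : x' (i + 1) = x (i + 1) := by simp [hx']
    rw [this]
    exact GW_inter_eq (hx.pos (i + 1) (by omega) (by omega)) _
  · refine Finset.sum_congr rfl fun I _ => Finset.prod_congr rfl fun i _ => ?_
    have hroot : ∀ μ : Measure WLTree, (∀ᵐ t ∂μ, t.label [] = some (x' i)) →
        μ (B' i) = μ (B i) := by
      intro μ hμ
      by_cases h : i = 0
      · subst h
        simp only [hx', if_true] at hμ
        simpa [hB'] using measure_inter_root hμ (B 0)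
      · simp [hB', h]
    by_cases hI : i = I
    · simp only [if_pos hI]
      exact hroot _ (ae_uniformLawAt_label_nil _)
    · simp only [if_neg hI]
      exact hroot _ (ae_GW_label_nil _)

instance (m : ℕ) (y : Fin (m + 1) → ℤ) (I : Fin (m + 1)) (i : Fin (m + 1)) :
    IsProbabilityMeasure (if i = I then uniformLaw.map (fun t => t.shift (y i)) else GW (y i)) := by
  split_ifs
  · exact inferInstanceAs (IsProbabilityMeasure (uniformLawAt (y i)))
  · infer_instance

/-! ### From probabilities of boxes to laws -/

theorem forestLaw_pi (m : ℕ) (y : Fin (m + 1) → ℤ) (T : Fin (m + 1) → Set WLTree) :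
    ((m : ℝ≥0∞) + 1) * forestLaw m y (Set.univ.pi T) = ∑ I : Fin (m + 1), ∏ i : Fin (m + 1),
      (if i = I then uniformLawAt (y i) else GW (y i)) (T i) := by
  rw [forestLaw, Measure.smul_apply, smul_eq_mul, ← mul_assoc,
    ENNReal.mul_inv_cancel (by simp) (by finiteness), one_mul, Measure.finsetSum_apply]
  refine Finset.sum_congr rfl fun I _ => ?_
  rw [Measure.pi_pi]
  rfl

instance (m : ℕ) (y : Fin (m + 1) → ℤ) : IsProbabilityMeasure (forestLaw m y) := by
  constructor
  have h := forestLaw_pi m y fun _ => Set.univ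
  have h1 : ∀ I i : Fin (m + 1),
      (if i = I then uniformLawAt (y i) else GW (y i)) Set.univ = 1 := by
    intro I i
    split_ifs <;> exact measure_univ
  simp only [h1, Finset.prod_const_one, Finset.sum_const, Finset.card_univ, Fintype.card_fin,
    Set.pi_univ, nsmul_eq_mul, mul_one, Nat.cast_add, Nat.cast_one] at h
  exact (ENNReal.mul_eq_left (by simp) (by finiteness)).1 h

theorem isCountablySpanning_boxes (ι : Type*) {α : Type*} [MeasurableSpace α] :
    IsCountablySpanning (Set.univ.pi '' Set.univ.pi fun _ : ι => {s : Set α | MeasurableSet s}) :=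
  ⟨fun _ => Set.univ, fun _ => ⟨fun _ => Set.univ, by simp, by simp⟩, Set.iUnion_const _⟩

/-- Products of measurable boxes form a π-system generating the product σ-algebra. -/
theorem ext_prod_pi {ι κ α : Type*} [Fintype ι] [Fintype κ] [MeasurableSpace α]
    {μ ν : Measure ((ι → α) × (κ → α))} [IsFiniteMeasure μ]
    (h : ∀ (S : ι → Set α) (T : κ → Set α), (∀ i, MeasurableSet (S i)) →
      (∀ i, MeasurableSet (T i)) →
      μ (Set.univ.pi S ×ˢ Set.univ.pi T) = ν (Set.univ.pi S ×ˢ Set.univ.pi T)) : μ = ν := by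
  refine ext_of_generate_finite _ (generateFrom_eq_prod generateFrom_pi generateFrom_pi
    (isCountablySpanning_boxes ι) (isCountablySpanning_boxes κ)).symm
    (isPiSystem_pi.prod isPiSystem_pi) ?_ ?_
  · rintro _ ⟨_, ⟨S, hS, rfl⟩, _, ⟨T, hT, rfl⟩, rfl⟩
    exact h S T (fun i => hS i trivial) fun i => hT i trivial
  · simpa using h (fun _ => Set.univ) (fun _ => Set.univ) (by simp) (by simp)

theorem uniformLaw_branch_pi {k m : ℕ} (hk : 1 ≤ k) {x : ℕ → ℤ} (hx : IsPosWalk m 1 k x)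
    {S : Fin m → Set WLTree} {T : Fin (m + 1) → Set WLTree} (hS : ∀ i, MeasurableSet (S i))
    (hT : ∀ i, MeasurableSet (T i)) :
    uniformLaw (branchEvent k m x ∩ (fun t => ((fun i : Fin m => t.tau k (i + 1)),
        fun i : Fin (m + 1) => t.tau' k i)) ⁻¹' (Set.univ.pi S ×ˢ Set.univ.pi T))
      = ENNReal.ofReal (((m : ℝ) + 1) / 3 ^ m * ∏ i ∈ Finset.Icc 1 m, w (x i)) *
        ((∏ i : Fin m, GWplus (x (i + 1)) (S i)) *
          forestLaw m (fun i => if i = 0 then 0 else x i) (Set.univ.pi T)) := by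
  classical
  -- Left trees are numbered from `1` and `S` from `0`, hence the shift; the value of `A` at `0`
  -- plays no role.
  let A : ℕ → Set WLTree := fun n => if h : n - 1 < m then S ⟨n - 1, h⟩ else Set.univ
  let B : ℕ → Set WLTree := fun n => if h : n < m + 1 then T ⟨n, h⟩ else Set.univ
  have hA : ∀ i, MeasurableSet (A i) := fun i => by
    by_cases h : i - 1 < m <;> simp [A, h, hS]
  have hB : ∀ i, MeasurableSet (B i) := fun i => by
    by_cases h : i < m + 1
    · simp only [B, dif_pos h, hT]
    · simp only [B, dif_neg h, MeasurableSet.univ]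
  have hA' : ∀ i : Fin m, A (i + 1) = S i := fun i => by simp [A]
  have hB' : ∀ i : Fin (m + 1), B i = T i := fun i => by simp only [B, dif_pos i.2]
  have hset : branchEvent k m x ∩ (fun t => ((fun i : Fin m => t.tau k (i + 1)),
        fun i : Fin (m + 1) => t.tau' k i)) ⁻¹' (Set.univ.pi S ×ˢ Set.univ.pi T)
      = {t | t ∈ branchEvent k m x ∧
        (∀ i, 1 ≤ i → i ≤ m → t.tau k i ∈ A i ∧ t.tau' k i ∈ B i) ∧ t.tau' k 0 ∈ B 0} := by
    ext t
    simp only [Set.mem_inter_iff, Set.mem_preimage, Set.mem_prod, Set.mem_univ_pi,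
      Set.mem_ofPred_eq]
    refine and_congr_right fun _ => ⟨fun ⟨h1, h2⟩ => ⟨fun i hi1 hi2 => ⟨?_, ?_⟩, ?_⟩,
      fun ⟨h1, h2⟩ => ⟨fun i => ?_, fun i => ?_⟩⟩
    · obtain ⟨i, rfl⟩ : ∃ i', i = i' + 1 := ⟨i - 1, by omega⟩
      exact hA' ⟨i, by omega⟩ ▸ h1 ⟨i, by omega⟩
    · exact hB' ⟨i, by omega⟩ ▸ h2 ⟨i, by omega⟩
    · exact hB' 0 ▸ h2 0
    · exact hA' i ▸ (h1 (i + 1) (by omega) (by omega)).1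
    · rw [← hB']
      rcases Nat.eq_zero_or_pos (i : ℕ) with h | h
      · rw [h]; exact h2
      · exact (h1 i h (by omega)).2
  have hw : ∀ i ∈ Finset.Icc 1 m, 0 ≤ w (x i) := fun i hi => by
    rw [Finset.mem_Icc] at hi
    exact (w_pos (hx.pos i hi.1 hi.2)).le
  have hZ : ENNReal.ofReal (((m : ℝ) + 1) / 3 ^ m * ∏ i ∈ Finset.Icc 1 m, w (x i))
      = ((m : ℝ≥0∞) + 1) * 3⁻¹ ^ m * ∏ i ∈ Finset.range m, ENNReal.ofReal (w (x (i + 1))) := by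
    rw [ENNReal.ofReal_mul (by positivity), ENNReal.ofReal_prod_of_nonneg hw, div_eq_mul_inv,
      ENNReal.ofReal_mul (by positivity), ENNReal.ofReal_inv_of_pos (by positivity),
      ENNReal.ofReal_pow (by norm_num), ENNReal.inv_pow, ENNReal.ofReal_add (by positivity) (by norm_num)]
    congr 1
    · simp
    · rw [← Finset.Ico_add_one_right_eq_Icc, Finset.prod_Ico_eq_prod_range]
      simp [add_comm]
  rw [hset, uniformLaw_branch_box hk hx hA hB, hZ, Finset.prod_mul_distrib]
  have hG : ∏ i ∈ Finset.range m, GWplus (x (i + 1)) (A (i + 1))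
      = ∏ i : Fin m, GWplus (x (i + 1)) (S i) := by
    rw [Finset.prod_range]
    exact Finset.prod_congr rfl fun i _ => by rw [hA']
  have hF := forestLaw_pi m (fun i => if i = 0 then 0 else x i) T
  have hsum : (∑ I ∈ Finset.range (m + 1), ∏ i ∈ Finset.range (m + 1),
          (if i = I then uniformLawAt (if i = 0 then 0 else x i)
            else GW (if i = 0 then 0 else x i)) (B i))
      = ∑ I : Fin (m + 1), ∏ i : Fin (m + 1), (if i = I then
          uniformLawAt (if i = 0 then 0 else x i) else GW (if i = 0 then 0 else x i)) (T i) := by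
    rw [Finset.sum_range]
    refine Finset.sum_congr rfl fun I _ => ?_
    rw [Finset.prod_range]
    refine Finset.prod_congr rfl fun i _ => ?_
    rw [hB']
    simp only [Fin.ext_iff, Fin.val_zero]
  rw [hG, hsum, ← hF]
  ring

end LabeledTree

theorem mainTheorem4 (k : ℕ) (hk : 1 ≤ k) :
    (∀ᵐ t ∂uniformLaw, t.X k 0 = 0) ∧
    (∀ᵐ t ∂uniformLaw, IsPosWalk (t.branchLength k) 1 k (t.X k)) ∧
    ∀ (m : ℕ) (x : ℕ → ℤ), IsPosWalk m 1 k x →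
      uniformLaw (branchEvent k m x)
          = ENNReal.ofReal (((m : ℝ) + 1) / 3 ^ m * ∏ i ∈ Finset.Icc 1 m, w (x i)) ∧
      IndepFun (fun t (i : Fin m) => t.tau k (i + 1)) (fun t (i : Fin (m + 1)) => t.tau' k i)
        uniformLaw[|branchEvent k m x] ∧
      iIndepFun (fun (i : Fin m) t => t.tau k (i + 1)) uniformLaw[|branchEvent k m x] ∧
      (∀ i : Fin m, uniformLaw[|branchEvent k m x].map (fun t => t.tau k (i + 1))
          = GWplus (x (i + 1))) ∧
      uniformLaw[|branchEvent k m x].map (fun t (i : Fin (m + 1)) => t.tau' k i)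
          = forestLaw m (fun i => if i = 0 then 0 else x i) := by
  refine ⟨?_, ?_, fun m x hx => ?_⟩
  · filter_upwards [ae_hits k] with t h using h.X_zero
  · filter_upwards [ae_hits k, ae_uniformLaw_label_nil] with t h h0
      using WLTree.isPosWalk_X hk h0 h
  have hprob : ∀ i : Fin m, IsProbabilityMeasure (GWplus (x (i + 1))) := fun i =>
    isProbabilityMeasure_GWplus (hx.pos _ (by omega) (by omega))
  have hbox := fun S T hS hT => uniformLaw_branch_pi hk hx (S := S) (T := T) hS hT
  set Z := ENNReal.ofReal (((m : ℝ) + 1) / 3 ^ m * ∏ i ∈ Finset.Icc 1 m, w (x i)) with hZ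
  have hE : uniformLaw (branchEvent k m x) = Z := by
    -- With no constraint on the trees, both laws on the right have mass one and only the constant
    -- remains.
    have h := hbox (fun _ => Set.univ) (fun _ => Set.univ) (by simp) (by simp)
    simpa using h
  have hZ0 : Z ≠ 0 := by
    rw [hZ]
    simp only [ne_eq, ENNReal.ofReal_eq_zero, not_le]
    refine mul_pos (by positivity) (Finset.prod_pos fun i hi => ?_)
    rw [Finset.mem_Icc] at hi
    exact w_pos (hx.pos i hi.1 hi.2)
  have hZt : Z ≠ ∞ := ENNReal.ofReal_ne_top
  have htau : Measurable fun (t : WLTree) (i : Fin m) => t.tau k (i + 1) :=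
    measurable_pi_iff.2 fun i => measurable_tau k _
  have htau' : Measurable fun (t : WLTree) (i : Fin (m + 1)) => t.tau' k i :=
    measurable_pi_iff.2 fun i => measurable_tau' k _
  have : IsProbabilityMeasure uniformLaw[|branchEvent k m x] :=
    cond_isProbabilityMeasure (by rwa [hE])
  -- The conditional joint law is a product measure; both independence statements and all the
  -- marginal laws are read off from it.
  have hjoint : uniformLaw[|branchEvent k m x].map (fun t => ((fun i : Fin m => t.tau k (i + 1)),
        fun i : Fin (m + 1) => t.tau' k i))
      = (Measure.pi fun i : Fin m => GWplus (x (i + 1))).prod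
        (forestLaw m (fun i => if i = 0 then 0 else x i)) := by
    have := Measure.isProbabilityMeasure_map (μ := uniformLaw[|branchEvent k m x])
      (htau.prodMk htau').aemeasurable
    refine ext_prod_pi fun S T hS hT => ?_
    rw [Measure.map_apply (htau.prodMk htau') ((MeasurableSet.univ_pi hS).prod
      (MeasurableSet.univ_pi hT)), cond_apply (measurableSet_branchEvent k m x), hbox S T hS hT, hE,
      ← mul_assoc, ENNReal.inv_mul_cancel hZ0 hZt, one_mul, Measure.prod_prod, Measure.pi_pi]
  have hfst : uniformLaw[|branchEvent k m x].map (fun t (i : Fin m) => t.tau k (i + 1))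
      = Measure.pi fun i : Fin m => GWplus (x (i + 1)) := by
    have h := congrArg (Measure.map Prod.fst) hjoint
    rw [Measure.map_map measurable_fst (htau.prodMk htau'), Measure.map_fst_prod, measure_univ,
      one_smul] at h
    exact h
  have hsnd : uniformLaw[|branchEvent k m x].map (fun t (i : Fin (m + 1)) => t.tau' k i)
      = forestLaw m (fun i => if i = 0 then 0 else x i) := by
    have h := congrArg (Measure.map Prod.snd) hjoint
    rw [Measure.map_map measurable_snd (htau.prodMk htau'), Measure.map_snd_prod, measure_univ,
      one_smul] at h
    exact h
  have hcoord : ∀ i : Fin m, uniformLaw[|branchEvent k m x].map (fun t => t.tau k (i + 1))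
      = GWplus (x (i + 1)) := by
    intro i
    have h := congrArg (Measure.map (Function.eval i)) hfst
    rw [Measure.map_map (measurable_pi_apply i) htau,
      (measurePreserving_eval (fun i : Fin m => GWplus (x (i + 1))) i).map_eq] at h
    exact h
  refine ⟨hE, ?_, ?_, hcoord, hsnd⟩
  · rw [indepFun_iff_map_prod_eq_prod_map_map htau.aemeasurable htau'.aemeasurable, hfst, hsnd]
    exact hjoint
  · rw [iIndepFun_iff_map_fun_eq_pi_map fun i => (measurable_tau k _).aemeasurable, hfst]
    congr 1
    funext i
    exact (hcoord i).symm
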